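/- Let $N$ be a compact smooth manifold, smoothly embedded in $\mathbb R^d$ and equipped with the Riemannian metric induced by the embedding; let $B$ denote its second fundamental form, $B(p)(v,w)\in (T_pN)^\perp$ for $v,w\in T_pN$. Let $U=U(x,t)$, $x\in\mathbb R^2$, $t>0$, be a smooth wave map to $N$, i.e. a smooth solution with values in $N\subset\mathbb R^d$ of $$\partial_\alpha\partial^\alpha U = B(U)(\partial_\alpha U,\partial^\alpha U)$$ (indices raised with the Minkowski metric of $\mathbb R^{2+1}$), which is radially symmetric (it depends on $|x|$ and $t$ only) and whose first derivatives in space and time have compact support in $x$ for each fixed $t$. For $S\subset\mathbb R^2$ write $$E(U(t),S)=\int_S\big(|\partial_tU|^2+|\partial_{x_1}U|^2+|\partial_{x_2}U|^2\big)(x,t)\,dx ,$$ and let $B_\rho(0)$ be the ball of radius $\rho$ about the origin of $\mathbb R^2$. Let $0<\lambda'<\lambda''<1$. There is an $\alpha\in(0,1)$, depending only on $\lambda'$ and $\lambda''$, with the following property. Let $N$ and $U$ be as above, let $\eta>0$, and let $(T_n)$ be a sequence of reals with $T_n\to\infty$ and $$\lim_{n\to\infty}\frac1{T_n}\int_{\frac58T_n}^{\frac78T_n}E\big(U(t),B_{\lambda't}(0)\big)\,dt=\eta$$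 (for instance $\eta=\limsup_{T\to\infty}\frac1T\int_{5T/8}^{7T/8}E(U(t),B_{\lambda't}(0))\,dt$, if this is positive, and $(T_n)$ a sequence that realizes the limsup). Then for all sufficiently large $n$ and every $t\in[\frac58T_n,\frac78T_n]$, $$E\big(U(t),B_{\lambda't}(0)\big)>\alpha\eta .$$ -/

import Mathlib

open Set Filter Topology MeasureTheory
open scoped ContDiff Manifold

noncomputable section

namespace WaveMap

/-- Euclidean space `ℝⁿ`. -/
abbrev Eu (n : ℕ) : Type := EuclideanSpace ℝ (Fin n)

/-- Space-time `ℝ^{2+1}`, with points written `(x, t)`. -/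
abbrev Spacetime : Type := Eu 2 × ℝ

/-- The unit vector of the time direction. -/
def timeDir : Spacetime := (0, 1)

/-- The unit vector of the `i`-th space direction. -/
def spaceDir (i : Fin 2) : Spacetime := (EuclideanSpace.single i 1, 0)

/-- The times `t > 0`. -/
def future : Set Spacetime := {z | 0 < z.2}

/-- The partial derivative of a vector-valued function on space-time in the direction `e`. -/
def pd {d : ℕ} (e : Spacetime) (u : Spacetime → Eu d) (z : Spacetime) : Eu d :=
  fderiv ℝ u z e

/-- `∂_α ∂^α u = -∂ₜ² u + Δ u`, for the Minkowski metric of signature `(-,+,+)`. -/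
def box {d : ℕ} (u : Spacetime → Eu d) (z : Spacetime) : Eu d :=
  - pd timeDir (pd timeDir u) z + ∑ i : Fin 2, pd (spaceDir i) (pd (spaceDir i) u) z

section Target

variable {d k : ℕ} {N : Type*} [TopologicalSpace N] [ChartedSpace (Eu k) N]

/-- The tangent space of `N` at `p`, seen as a subspace of `ℝᵈ` through `ι : N → ℝᵈ`. -/
def tangentPlane (ι : N → Eu d) (p : N) : Submodule ℝ (Eu d) :=
  LinearMap.range (mfderiv 𝓘(ℝ, Eu k) 𝓘(ℝ, Eu d) ι p : Eu k →L[ℝ] Eu d).toLinearMap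

/-- The tangential vector field on `N` that sends `q` to the orthogonal projection of the fixed
vector `w` of `ℝᵈ` to the tangent space at `q`. -/
def tangentField (ι : N → Eu d) (w : Eu d) (q : N) : Eu d :=
  (tangentPlane (k := k) ι q).starProjection w

/-- The second fundamental form of `ι : N → ℝᵈ` at `p`, on tangent vectors `ξ, ζ` of `N` at `p`:
the component normal to `N` of the derivative, in the direction `ξ`, of a tangential vector field
whose value at `p` is (the image in `ℝᵈ` of) `ζ`. -/
def secondFundamentalForm (ι : N → Eu d) (p : N)
    (ξ ζ : TangentSpace 𝓘(ℝ, Eu k) p) : Eu d :=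
  (tangentPlane (k := k) ι p)ᗮ.starProjection
    (mfderiv 𝓘(ℝ, Eu k) 𝓘(ℝ, Eu d)
      (tangentField (k := k) ι (mfderiv 𝓘(ℝ, Eu k) 𝓘(ℝ, Eu d) ι p ζ)) p ξ)

/-- The partial derivative of a map from space-time to `N` in the direction `e`, a tangent vector
of `N`. -/
def tpd (k : ℕ) {N : Type*} [TopologicalSpace N] [ChartedSpace (Eu k) N]
    (e : Spacetime) (U : Spacetime → N) (z : Spacetime) :
    TangentSpace 𝓘(ℝ, Eu k) (U z) :=
  mfderiv 𝓘(ℝ, Spacetime) 𝓘(ℝ, Eu k) U z e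

/-- `B(U)(∂_α U, ∂^α U)`, where `B` is the second fundamental form of `ι`. -/
def nonlinearity (k : ℕ) {N : Type*} [TopologicalSpace N] [ChartedSpace (Eu k) N]
    (ι : N → Eu d) (U : Spacetime → N) (z : Spacetime) : Eu d :=
  - secondFundamentalForm ι (U z) (tpd k timeDir U z) (tpd k timeDir U z)
    + ∑ i : Fin 2,
        secondFundamentalForm ι (U z) (tpd k (spaceDir i) U z) (tpd k (spaceDir i) U z)

/-- `U` is a smooth wave map, for `t > 0`, to the manifold `N` embedded in `ℝᵈ` by `ι`:
`∂_α ∂^α U = B(U)(∂_α U, ∂^α U)`. -/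
structure IsSmoothWaveMap (k : ℕ) {N : Type*} [TopologicalSpace N] [ChartedSpace (Eu k) N]
    (ι : N → Eu d) (U : Spacetime → N) : Prop where
  smooth : ContMDiffOn 𝓘(ℝ, Spacetime) 𝓘(ℝ, Eu k) ∞ U future
  equation : ∀ z ∈ future, box (ι ∘ U) z = nonlinearity k ι U z

end Target

/-- `U` is radially symmetric: at each time it depends on `|x|` only. -/
def IsRadial {N : Type*} (U : Spacetime → N) : Prop :=
  ∀ t : ℝ, 0 < t → ∀ x y : Eu 2, ‖x‖ = ‖y‖ → U (x, t) = U (y, t)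

/-- At each time, the first derivatives of `u` in space and time have compact support in space. -/
def HasCompactlySupportedDerivatives {d : ℕ} (u : Spacetime → Eu d) : Prop :=
  ∀ t : ℝ, 0 < t →
    HasCompactSupport (fun x : Eu 2 => pd timeDir u (x, t)) ∧
    ∀ i : Fin 2, HasCompactSupport (fun x : Eu 2 => pd (spaceDir i) u (x, t))

/-- The energy `E(u(t), S) = ∫_S (|∂ₜ u|² + |∂₁ u|² + |∂₂ u|²) dx` at time `t` in `S ⊆ ℝ²`. -/
def energy {d : ℕ} (u : Spacetime → Eu d) (t : ℝ) (S : Set (Eu 2)) : ℝ :=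
  ∫ x in S, (‖pd timeDir u (x, t)‖ ^ 2 + ∑ i : Fin 2, ‖pd (spaceDir i) u (x, t)‖ ^ 2)

/-- `(1/T) ∫_{5T/8}^{7T/8} E(u(t), B_{lt}(0)) dt`. -/
def averagedEnergy {d : ℕ} (u : Spacetime → Eu d) (l T : ℝ) : ℝ :=
  (1 / T) * ∫ t in (5 / 8 * T)..(7 / 8 * T), energy u t (Metric.ball 0 (l * t))

end WaveMap

end

/-! The wave operator of a wave map is normal to `N`, while its first derivatives are tangent. For
radial `u`, pairing with `∂ₜu` and `∂ᵣu` therefore removes the nonlinearity and gives two laws for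
`e = r(|∂ₜu|² + |∂ᵣu|²)/2` and `m = r ∂ₜu·∂ᵣu`: `∂ₜe = ∂ᵣm` and `∂ₜm = ∂ᵣe - (|∂ₜu|² - |∂ᵣu|²)/2`.
The rest of the argument uses these laws and `|m| ≤ e`.

Energy travels at speed at most one (`ballEnergy_le`). Moreover, the momentum weighted by `profile
(r / (t + R + 1))` is bounded and nonincreasing, and it decreases at least at the rate `κ / t` times
the energy in `l₁ t ≤ r ≤ l₂ t` (`integral_bulk_ge`). Being convergent, it can drop only little on a
late interval `[s, (1 + δ) s]`, whereas `dt / t` has mass `log (1 + δ)` there; so some time `g` in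
it has little energy in the annulus (`exists_annulus_energy_le`).

Take the annulus from `l' g / 2` to `l'' g`. Finite speed bounds the energy of `B_{l' t}` at time
`t` by that of `B_{l'' g}` at `g`, and the energy of `B_{l' g / 2}` at `g` by that of `B_{l' s}` at
`s`. So the energy at `t` exceeds that at `s` by at most a small error whenever `t` is near `s`,
before or after it, and boundedly many such steps cover `[5T/8, 7T/8]` (`exists_ballEnergy_le_add`).
An energy at most `η / 2` at one time would then be at most `η` throughout, forcing the average to
be at most `η / 4`. -/

namespace WaveMap

/-! ### Differentiation of integrals with a moving endpoint. -/

/-- Differentiation of an integral over `[0, p + q t]` whose integrand depends on `t`. -/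
theorem hasDerivAt_integral_affine_endpoint {F : ℝ × ℝ → ℝ} {Ω : Set (ℝ × ℝ)} (hΩ : IsOpen Ω)
    (hF : ContDiffOn ℝ 1 F Ω) (p q t₀ : ℝ)
    (hseg : ∀ s ∈ Icc (0 : ℝ) 1, ((p + q * t₀) * s, t₀) ∈ Ω) :
    HasDerivAt (fun t => ∫ r in (0 : ℝ)..(p + q * t), F (r, t))
      (q * F (p + q * t₀, t₀) + ∫ r in (0 : ℝ)..(p + q * t₀), fderiv ℝ F (r, t₀) (0, 1)) t₀ := by
  have hd : ∀ z ∈ Ω, HasFDerivAt F (fderiv ℝ F z) z := fun z hz =>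
    ((hF.contDiffAt (hΩ.mem_nhds hz)).differentiableAt one_ne_zero).hasFDerivAt
  have hfc : ContinuousOn (fderiv ℝ F) Ω := hF.continuousOn_fderiv_of_isOpen hΩ le_rfl
  let φ : ℝ × ℝ → ℝ × ℝ := fun z => ((p + q * z.1) * z.2, z.1)
  have hφ : Continuous φ := by fun_prop
  -- The substitution `r = (p + q t) s` moves the dependence on the endpoint into the integrand over
  -- `[0, 1]`.
  let G : ℝ → ℝ → ℝ := fun t s => (p + q * t) * F (φ (t, s))
  let G' : ℝ → ℝ → ℝ := fun t s =>
    q * F (φ (t, s)) + (p + q * t) * fderiv ℝ F (φ (t, s)) (q * s, 1)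
  have hGd : ∀ t s, φ (t, s) ∈ Ω → HasDerivAt (fun t => G t s) (G' t s) t := by
    intro t s h
    have h1 : HasDerivAt (fun t => p + q * t) q t := by
      simpa using ((hasDerivAt_id t).const_mul q).const_add p
    have h2 : HasDerivAt (fun t => φ (t, s)) (q * s, 1) t :=
      (h1.mul_const s).prodMk (hasDerivAt_id t)
    exact h1.mul (HasFDerivAt.comp_hasDerivAt (f := fun t => φ (t, s)) t (hd _ h) h2)
  have hΩ' : IsOpen (φ ⁻¹' Ω) := hΩ.preimage hφ
  have hG'c : ContinuousOn (fun z : ℝ × ℝ => G' z.1 z.2) (φ ⁻¹' Ω) := by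
    have e1 : ContinuousOn (fun z : ℝ × ℝ => F (φ z)) (φ ⁻¹' Ω) :=
      hF.continuousOn.comp hφ.continuousOn (fun _ h => h)
    have e2 : ContinuousOn (fun z : ℝ × ℝ => fderiv ℝ F (φ z)) (φ ⁻¹' Ω) :=
      hfc.comp hφ.continuousOn (fun _ h => h)
    have e3 : ContinuousOn (fun z : ℝ × ℝ => fderiv ℝ F (φ z) (q * z.2, 1)) (φ ⁻¹' Ω) :=
      e2.clm_apply (by fun_prop)
    exact (continuousOn_const.mul e1).add ((by fun_prop : Continuous fun z : ℝ × ℝ =>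
      p + q * z.1).continuousOn.mul e3)
  have hGc : ContinuousOn (fun z : ℝ × ℝ => G z.1 z.2) (φ ⁻¹' Ω) := by
    have e1 : ContinuousOn (fun z : ℝ × ℝ => F (φ z)) (φ ⁻¹' Ω) :=
      hF.continuousOn.comp hφ.continuousOn (fun _ h => h)
    exact (by fun_prop : Continuous fun z : ℝ × ℝ => p + q * z.1).continuousOn.mul e1
  obtain ⟨V, W, hV, -, htV, hIW, hVW⟩ := generalized_tube_lemma (s := {t₀})
    (t := Icc (0 : ℝ) 1) isCompact_singleton isCompact_Icc hΩ' (by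
      rintro ⟨t, s⟩ ⟨ht, hs⟩
      obtain rfl : t = t₀ := ht
      exact hseg s hs)
  obtain ⟨ε, hε, hball⟩ := Metric.nhds_basis_closedBall.mem_iff.1
    (hV.mem_nhds (htV rfl))
  have hsub : Metric.closedBall t₀ ε ×ˢ Icc (0 : ℝ) 1 ⊆ φ ⁻¹' Ω :=
    (Set.prod_mono hball hIW).trans hVW
  obtain ⟨C, hC⟩ := ((isCompact_closedBall t₀ ε).prod isCompact_Icc).exists_bound_of_continuousOn
    (hG'c.mono hsub)
  have hIoc : uIoc (0 : ℝ) 1 ⊆ Icc 0 1 := by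
    rw [uIoc_of_le zero_le_one]; exact Ioc_subset_Icc_self
  have slice : ∀ (K : ℝ × ℝ → ℝ), ContinuousOn K (φ ⁻¹' Ω) → ∀ t ∈ Metric.closedBall t₀ ε,
      ContinuousOn (fun s => K (t, s)) (Icc 0 1) := fun K hK t ht =>
    hK.comp (by fun_prop) (fun s hs => hsub ⟨ht, hs⟩)
  have ht₀ : t₀ ∈ Metric.closedBall t₀ ε := Metric.mem_closedBall_self hε.le
  have key := (intervalIntegral.hasDerivAt_integral_of_dominated_loc_of_deriv_le
    (μ := volume) (a := 0) (b := 1) (F := G) (F' := G') (bound := fun _ => C)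
    (Metric.closedBall_mem_nhds t₀ hε)
    (by
      filter_upwards [Metric.closedBall_mem_nhds t₀ hε] with t ht
      exact ((slice _ hGc t ht).mono hIoc).aestronglyMeasurable measurableSet_uIoc)
    ((slice _ hGc t₀ ht₀).intervalIntegrable_of_Icc zero_le_one)
    (((slice _ hG'c t₀ ht₀).mono hIoc).aestronglyMeasurable measurableSet_uIoc)
    (ae_of_all _ fun s hs t ht => hC (t, s) ⟨ht, hIoc hs⟩)
    intervalIntegrable_const
    (ae_of_all _ fun s hs t ht => hGd t s (hsub ⟨ht, hIoc hs⟩))).2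
  have hfun : (fun t => ∫ r in (0 : ℝ)..(p + q * t), F (r, t)) =
      fun t => ∫ s in (0 : ℝ)..1, G t s := by
    funext t
    have := intervalIntegral.smul_integral_comp_mul_left (a := 0) (b := 1)
      (fun r => F (r, t)) (p + q * t)
    simp only [mul_zero, mul_one, smul_eq_mul] at this
    rw [← this, ← intervalIntegral.integral_const_mul]
  rw [hfun]
  refine key.congr_deriv ?_
  have hchange := intervalIntegral.smul_integral_comp_mul_left (a := 0) (b := 1)
    (fun r => fderiv ℝ F (r, t₀) (0, 1)) (p + q * t₀)
  simp only [mul_zero, mul_one, smul_eq_mul] at hchange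
  rw [← hchange]
  have hFt : ContinuousOn (fun s => fderiv ℝ F (φ (t₀, s)) (0, 1)) (Icc (0 : ℝ) 1) :=
    slice (fun z => fderiv ℝ F (φ z) (0, 1))
      ((hfc.comp hφ.continuousOn (fun _ h => h)).clm_apply continuousOn_const) t₀ ht₀
  have hG's := slice _ hG'c t₀ ht₀
  -- Apart from the `∂ₜF` term, `G'` is the `s`-derivative of `q s F`, whose integral is the
  -- boundary term.
  have hftc : ∫ s in (0 : ℝ)..1, (G' t₀ s - (p + q * t₀) * fderiv ℝ F (φ (t₀, s)) (0, 1)) =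
      q * (1 * F (φ (t₀, 1))) - q * (0 * F (φ (t₀, 0))) := by
    apply intervalIntegral.integral_eq_sub_of_hasDerivAt (f := fun s => q * (s * F (φ (t₀, s))))
    · intro s hs
      rw [uIcc_of_le zero_le_one] at hs
      have h2 : HasDerivAt (fun s => φ (t₀, s)) (p + q * t₀, 0) s := by
        have h1 : HasDerivAt (fun s => (p + q * t₀) * s) (p + q * t₀) s := by
          simpa using (hasDerivAt_id s).const_mul (p + q * t₀)
        exact h1.prodMk (hasDerivAt_const s t₀)
      have h3 := ((hasDerivAt_id s).mul 
        (HasFDerivAt.comp_hasDerivAt (f := fun s => φ (t₀, s)) s (hd _ (hseg s hs)) h2)).const_mul q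
      refine h3.congr_deriv ?_
      have e1 : ((q * s, 1) : ℝ × ℝ) = (q * s) • ((1, 0) : ℝ × ℝ) + (0, 1) := by simp
      have e2 : ((p + q * t₀, 0) : ℝ × ℝ) = (p + q * t₀) • ((1, 0) : ℝ × ℝ) := by simp
      simp only [G', e1, e2, map_add, map_smul, smul_eq_mul, id]
      simp only [φ, Function.comp]
      ring
    · exact (hG's.sub (continuousOn_const.mul hFt)).intervalIntegrable_of_Icc zero_le_one
  have i1 : IntervalIntegrable (G' t₀) volume 0 1 := hG's.intervalIntegrable_of_Icc zero_le_one
  have i2 : IntervalIntegrable (fun s => (p + q * t₀) * fderiv ℝ F (φ (t₀, s)) (0, 1)) volume 0 1 :=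
    (continuousOn_const.mul hFt).intervalIntegrable_of_Icc zero_le_one
  rw [intervalIntegral.integral_sub i1 i2, intervalIntegral.integral_const_mul] at hftc
  simp only [φ, mul_one, one_mul, zero_mul, mul_zero, sub_zero] at hftc ⊢
  linarith

/-! ### Radial conservation laws and finite speed of propagation. -/

/-- The half-plane of points `(r, t)` with `t > 0`. -/
def positiveTime : Set (ℝ × ℝ) := {z | 0 < z.2}

theorem isOpen_positiveTime : IsOpen positiveTime := isOpen_lt continuous_const continuous_snd

/-- The quadratic densities `|∂ₜv|²`, `|∂ᵣv|²` and `∂ₜv · ∂ᵣv` of a radial field in the plane, with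
the conservation laws of energy and radial momentum. -/
structure RadialDensities where
  kin : ℝ × ℝ → ℝ
  grad : ℝ × ℝ → ℝ
  mom : ℝ × ℝ → ℝ
  contDiffOn_kin : ContDiffOn ℝ 1 kin positiveTime
  contDiffOn_grad : ContDiffOn ℝ 1 grad positiveTime
  contDiffOn_mom : ContDiffOn ℝ 1 mom positiveTime
  kin_nonneg : ∀ z, 0 ≤ kin z
  grad_nonneg : ∀ z, 0 ≤ grad z
  mom_sq_le : ∀ z, mom z ^ 2 ≤ kin z * grad z
  energy_law : ∀ r t, 0 < r → 0 < t →
    fderiv ℝ (fun z : ℝ × ℝ => z.1 * ((kin z + grad z) / 2)) (r, t) (0, 1) =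
      fderiv ℝ (fun z : ℝ × ℝ => z.1 * mom z) (r, t) (1, 0)
  momentum_law : ∀ r t, 0 < r → 0 < t →
    fderiv ℝ (fun z : ℝ × ℝ => z.1 * mom z) (r, t) (0, 1) =
      fderiv ℝ (fun z : ℝ × ℝ => z.1 * ((kin z + grad z) / 2)) (r, t) (1, 0)
        - (kin (r, t) - grad (r, t)) / 2

namespace RadialDensities

variable (W : RadialDensities)

/-- The energy density with respect to `dr`. -/
noncomputable def energyDensity (z : ℝ × ℝ) : ℝ := z.1 * ((W.kin z + W.grad z) / 2)

/-- The density of radial momentum with respect to `dr`. -/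
def momentumDensity (z : ℝ × ℝ) : ℝ := z.1 * W.mom z

/-- The energy at time `t` in the ball of radius `ρ`, up to a constant factor. -/
noncomputable def ballEnergy (t ρ : ℝ) : ℝ := ∫ r in (0 : ℝ)..ρ, W.energyDensity (r, t)

theorem contDiffOn_energyDensity : ContDiffOn ℝ 1 W.energyDensity positiveTime :=
  contDiffOn_fst.mul ((W.contDiffOn_kin.add W.contDiffOn_grad).div_const 2)

theorem contDiffOn_momentumDensity : ContDiffOn ℝ 1 W.momentumDensity positiveTime :=
  contDiffOn_fst.mul W.contDiffOn_mom

theorem continuous_slice {X : Type*} [TopologicalSpace X] {f : ℝ × ℝ → X}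
    (hf : ContinuousOn f positiveTime) {t : ℝ} (ht : 0 < t) : Continuous fun r => f (r, t) :=
  hf.comp_continuous (by fun_prop) (fun _ => ht)

theorem continuous_energyDensity {t : ℝ} (ht : 0 < t) :
    Continuous fun r => W.energyDensity (r, t) :=
  continuous_slice W.contDiffOn_energyDensity.continuousOn ht

theorem continuous_momentumDensity {t : ℝ} (ht : 0 < t) :
    Continuous fun r => W.momentumDensity (r, t) :=
  continuous_slice W.contDiffOn_momentumDensity.continuousOn ht

theorem energyDensity_nonneg {r : ℝ} (hr : 0 ≤ r) (t : ℝ) : 0 ≤ W.energyDensity (r, t) :=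
  mul_nonneg hr (by have := W.kin_nonneg (r, t); have := W.grad_nonneg (r, t); positivity)

theorem abs_momentumDensity_le {r : ℝ} (hr : 0 ≤ r) (t : ℝ) :
    |W.momentumDensity (r, t)| ≤ W.energyDensity (r, t) := by
  have h1 := W.kin_nonneg (r, t)
  have h2 := W.grad_nonneg (r, t)
  have h3 := W.mom_sq_le (r, t)
  rw [momentumDensity, energyDensity, abs_mul, abs_of_nonneg hr]
  refine mul_le_mul_of_nonneg_left (abs_le_of_sq_le_sq ?_ (by positivity)) hr
  nlinarith [sq_nonneg (W.kin (r, t) - W.grad (r, t))]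

theorem ballEnergy_sub {t : ℝ} (ht : 0 < t) (ρ₁ ρ₂ : ℝ) :
    W.ballEnergy t ρ₂ - W.ballEnergy t ρ₁ = ∫ r in ρ₁..ρ₂, W.energyDensity (r, t) :=
  intervalIntegral.integral_interval_sub_left
    ((W.continuous_energyDensity ht).intervalIntegrable _ _)
    ((W.continuous_energyDensity ht).intervalIntegrable _ _)

theorem ballEnergy_mono {t : ℝ} (ht : 0 < t) {ρ₁ ρ₂ : ℝ} (h₁ : 0 ≤ ρ₁) (h : ρ₁ ≤ ρ₂) :
    W.ballEnergy t ρ₁ ≤ W.ballEnergy t ρ₂ := by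
  rw [← sub_nonneg, W.ballEnergy_sub ht]
  exact intervalIntegral.integral_nonneg h fun r hr => W.energyDensity_nonneg (h₁.trans hr.1) t

theorem hasDerivAt_slice {f : ℝ × ℝ → ℝ} (hf : ContDiffOn ℝ 1 f positiveTime) (r : ℝ) {t : ℝ}
    (ht : 0 < t) : HasDerivAt (fun r => f (r, t)) (fderiv ℝ f (r, t) (1, 0)) r := by
  have h1 : HasFDerivAt f (fderiv ℝ f (r, t)) (r, t) :=
    ((hf.contDiffAt (isOpen_positiveTime.mem_nhds ht)).differentiableAt one_ne_zero).hasFDerivAt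
  exact HasFDerivAt.comp_hasDerivAt (f := fun r => (r, t)) r h1
    ((hasDerivAt_id r).prodMk (hasDerivAt_const r t))

theorem continuous_fderiv_slice {f : ℝ × ℝ → ℝ} (hf : ContDiffOn ℝ 1 f positiveTime) (v : ℝ × ℝ)
    {t : ℝ} (ht : 0 < t) : Continuous fun r => fderiv ℝ f (r, t) v :=
  (continuous_slice (hf.continuousOn_fderiv_of_isOpen isOpen_positiveTime le_rfl) ht).clm_apply
    continuous_const

/-- Integrating `∂ₜe = ∂ᵣm` leaves only the flux through the outer endpoint: the momentum density
carries a factor `r`, hence vanishes at the centre. -/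
theorem hasDerivAt_ballEnergy (p q : ℝ) {t : ℝ} (ht : 0 < t) (hρ : 0 ≤ p + q * t) :
    HasDerivAt (fun t => W.ballEnergy t (p + q * t))
      (q * W.energyDensity (p + q * t, t) + W.momentumDensity (p + q * t, t)) t := by
  refine (hasDerivAt_integral_affine_endpoint isOpen_positiveTime W.contDiffOn_energyDensity
    p q t (fun _ _ => ht)).congr_deriv ?_
  congr 1
  rw [intervalIntegral.integral_eq_sub_of_hasDerivAt_of_le
    (f := fun r => W.momentumDensity (r, t)) hρ (W.continuous_momentumDensity ht).continuousOn]
  · simp [momentumDensity]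
  · intro r hr
    refine (hasDerivAt_slice W.contDiffOn_momentumDensity r ht).congr_deriv ?_
    exact (W.energy_law r t hr.1 ht).symm
  · exact (continuous_fderiv_slice W.contDiffOn_energyDensity _ ht).intervalIntegrable _ _

/-- The energy in a ball is at most the energy at another time in the domain of dependence. -/
theorem ballEnergy_le {s t ρ : ℝ} (hs : 0 < s) (ht : 0 < t) (hρ : 0 ≤ ρ) :
    W.ballEnergy t ρ ≤ W.ballEnergy s (ρ + |t - s|) := by
  rcases le_total s t with h | h
  -- On the ball whose radius shrinks at unit speed the energy has derivative `-e + m ≤ 0`; in the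
  -- other case the radius grows and the derivative is `e + m ≥ 0`.
  · have hd : ∀ x ∈ Icc s t, HasDerivAt (fun x => W.ballEnergy x ((ρ + t) + (-1) * x))
        (-1 * W.energyDensity ((ρ + t) + (-1) * x, x) +
          W.momentumDensity ((ρ + t) + (-1) * x, x)) x :=
      fun x hx => W.hasDerivAt_ballEnergy _ _ (hs.trans_le hx.1) (by linarith [hx.2])
    have := antitoneOn_of_hasDerivWithinAt_nonpos (convex_Icc s t)
      (fun x hx => (hd x hx).continuousAt.continuousWithinAt)
      (fun x hx => (hd x (interior_subset hx)).hasDerivWithinAt)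
      (fun x hx => by
        have hx := interior_subset hx
        have := le_of_abs_le (W.abs_momentumDensity_le
          (r := (ρ + t) + (-1) * x) (by linarith [hx.2]) x)
        linarith) (left_mem_Icc.2 h) (right_mem_Icc.2 h) h
    rw [abs_of_nonneg (sub_nonneg.2 h)]
    beta_reduce at this
    rwa [show ρ + t + -1 * t = ρ by ring, show ρ + t + -1 * s = ρ + (t - s) by ring] at this
  · have hd : ∀ x ∈ Icc t s, HasDerivAt (fun x => W.ballEnergy x ((ρ - t) + 1 * x))
        (1 * W.energyDensity ((ρ - t) + 1 * x, x) + W.momentumDensity ((ρ - t) + 1 * x, x)) x :=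
      fun x hx => W.hasDerivAt_ballEnergy _ _ (ht.trans_le hx.1) (by linarith [hx.1])
    have := monotoneOn_of_hasDerivWithinAt_nonneg (convex_Icc t s)
      (fun x hx => (hd x hx).continuousAt.continuousWithinAt)
      (fun x hx => (hd x (interior_subset hx)).hasDerivWithinAt)
      (fun x hx => by
        have hx := interior_subset hx
        have := neg_le_of_abs_le (W.abs_momentumDensity_le
          (r := (ρ - t) + 1 * x) (by linarith [hx.1]) x)
        linarith) (left_mem_Icc.2 h) (right_mem_Icc.2 h) h
    rw [abs_of_nonpos (sub_nonpos.2 h)]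
    beta_reduce at this
    rwa [show ρ - t + 1 * t = ρ by ring, show ρ - t + 1 * s = ρ + -(t - s) by ring] at this

variable {W}

theorem ballEnergy_one_eq {R : ℝ} (hsupp : ∀ r, R ≤ r → W.energyDensity (r, 1) = 0)
    {ρ : ℝ} (h : R ≤ ρ) : W.ballEnergy 1 ρ = W.ballEnergy 1 R := by
  rw [← sub_eq_zero, W.ballEnergy_sub one_pos]
  refine (intervalIntegral.integral_congr (g := fun _ => 0) fun r hr => ?_).trans (by simp)
  rw [uIcc_of_le h] at hr
  exact hsupp r hr.1

theorem ballEnergy_le_initial {R : ℝ} (hsupp : ∀ r, R ≤ r → W.energyDensity (r, 1) = 0)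
    {t ρ : ℝ} (ht : 0 < t) (hρ : 0 ≤ ρ) :
    W.ballEnergy t ρ ≤ W.ballEnergy 1 R := by
  refine (W.ballEnergy_le one_pos ht hρ).trans ?_
  rw [← ballEnergy_one_eq hsupp (le_max_left R (ρ + |t - 1|))]
  exact W.ballEnergy_mono one_pos (by positivity) (le_max_right _ _)

/-- Finite speed of propagation. -/
theorem energyDensity_eq_zero {R : ℝ} (hR : 0 ≤ R)
    (hsupp : ∀ r, R ≤ r → W.energyDensity (r, 1) = 0) {r t : ℝ} (ht : 1 ≤ t) (hr : R + t ≤ r) :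
    W.energyDensity (r, t) = 0 := by
  have ht0 : 0 < t := by linarith
  -- The ball of radius `R + (t - 1)` at time `t` already holds all the energy. The interval from
  -- there to `r` has length at least one, so a nonzero density at its endpoint would, by
  -- continuity, carry additional energy.
  have h1 : W.ballEnergy 1 R ≤ W.ballEnergy t (R + (t - 1)) := by
    have := W.ballEnergy_le ht0 one_pos hR
    rwa [abs_sub_comm, abs_of_nonneg (by linarith)] at this
  have h2 : W.ballEnergy t r ≤ W.ballEnergy 1 R :=
    ballEnergy_le_initial hsupp ht0 (by linarith)
  have h3 := W.ballEnergy_sub ht0 (R + (t - 1)) r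
  by_contra hne
  have : 0 < ∫ r in (R + (t - 1))..r, W.energyDensity (r, t) := by
    apply intervalIntegral.integral_pos (by linarith)
      (W.continuous_energyDensity ht0).continuousOn
      (fun x hx => W.energyDensity_nonneg (by linarith [hx.1]) t)
    exact ⟨r, right_mem_Icc.2 (by linarith),
      lt_of_le_of_ne (W.energyDensity_nonneg (by linarith) t) (Ne.symm hne)⟩
  linarith

theorem momentumDensity_eq_zero {R : ℝ} (hR : 0 ≤ R)
    (hsupp : ∀ r, R ≤ r → W.energyDensity (r, 1) = 0) {r t : ℝ} (ht : 1 ≤ t) (hr : R + t ≤ r) :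
    W.momentumDensity (r, t) = 0 := by
  have := W.abs_momentumDensity_le (r := r) (by linarith) t
  rw [energyDensity_eq_zero hR hsupp ht hr] at this
  exact abs_nonpos_iff.1 this

end RadialDensities

/-! ### The radial multiplier and its coercivity. -/

/-- The profile `x (1 - √(1 - x²))` of the radial multiplier. -/
noncomputable def profile (x : ℝ) : ℝ := x * (1 - √(1 - x ^ 2))

/-- The derivative of `profile` on `(-1, 1)`. -/
noncomputable def profileDeriv (x : ℝ) : ℝ := 1 - √(1 - x ^ 2) + x ^ 2 / √(1 - x ^ 2)

theorem one_sub_sq_pos {x : ℝ} (hx : |x| < 1) : 0 < 1 - x ^ 2 := by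
  have := (sq_lt_one_iff_abs_lt_one x).2 hx
  linarith

theorem hasDerivAt_profile {x : ℝ} (hx : |x| < 1) :
    HasDerivAt profile (profileDeriv x) x := by
  have h0 := one_sub_sq_pos hx
  have hc := Real.sqrt_pos.2 h0
  have h1 : HasDerivAt (fun x : ℝ => 1 - x ^ 2) (-(2 * x)) x := by
    simpa using (hasDerivAt_pow 2 x).const_sub 1
  have h2 := (hasDerivAt_id x).mul ((h1.sqrt h0.ne').const_sub 1)
  refine h2.congr_deriv ?_
  simp only [profileDeriv, id]
  field_simp

theorem contDiffAt_profile {x : ℝ} (hx : |x| < 1) : ContDiffAt ℝ 1 profile x := by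
  have h0 := one_sub_sq_pos hx
  unfold profile
  exact contDiffAt_id.mul (contDiffAt_const.sub
    ((contDiffAt_const.sub (contDiffAt_id.pow 2)).sqrt h0.ne'))

theorem sqrt_one_sub_sq_le_one (x : ℝ) : √(1 - x ^ 2) ≤ 1 :=
  Real.sqrt_le_one.2 (by nlinarith [sq_nonneg x])

theorem profile_nonneg {x : ℝ} (hx : 0 ≤ x) : 0 ≤ profile x :=
  mul_nonneg hx (sub_nonneg.2 (sqrt_one_sub_sq_le_one x))

theorem profile_le_one {x : ℝ} (hx : 0 ≤ x) (hx1 : x ≤ 1) : profile x ≤ 1 := by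
  have := Real.sqrt_nonneg (1 - x ^ 2)
  unfold profile
  nlinarith

theorem profile_pos {x : ℝ} (hx : 0 < x) : 0 < profile x := by
  refine mul_pos hx (sub_pos.2 ?_)
  rw [Real.sqrt_lt' one_pos]
  nlinarith

theorem profile_mono {x y : ℝ} (hx : 0 ≤ x) (hxy : x ≤ y) : profile x ≤ profile y := by
  have : √(1 - y ^ 2) ≤ √(1 - x ^ 2) := Real.sqrt_le_sqrt (by nlinarith)
  exact mul_le_mul hxy (by linarith) (sub_nonneg.2 (sqrt_one_sub_sq_le_one x)) (hx.trans hxy)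

/-- A quadratic form with nonnegative coefficients `A`, `B` and `AB ≥ k²` is nonnegative. -/
theorem quadratic_nonneg {A B k a b m : ℝ} (hA : 0 ≤ A) (hB : 0 ≤ B) (hk : k ^ 2 ≤ A * B)
    (ha : 0 ≤ a) (hb : 0 ≤ b) (hm : m ^ 2 ≤ a * b) : 0 ≤ A * a + B * b + 2 * (k * m) := by
  have h1 : (2 * (k * m)) ^ 2 ≤ (A * a + B * b) ^ 2 := by
    have : k ^ 2 * m ^ 2 ≤ (A * B) * (a * b) :=
      mul_le_mul hk hm (sq_nonneg m) (mul_nonneg hA hB)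
    nlinarith [sq_nonneg (A * a - B * b)]
  have := neg_le_of_abs_le (abs_le_of_sq_le_sq h1 (by positivity))
  linarith

/-- Coercivity of the bulk term of the multiplier identity. -/
theorem profile_coercive {x a b m : ℝ} (hx : 0 ≤ x) (hx1 : x < 1) (ha : 0 ≤ a) (hb : 0 ≤ b)
    (hm : m ^ 2 ≤ a * b) :
    profile x * (1 - x ^ 2) * ((a + b) / 2) ≤
      x * profileDeriv x * ((a + b) / 2) + x ^ 2 * profileDeriv x * m
        + profile x * ((a - b) / 2) := by
  have h0 : 0 < 1 - x ^ 2 := one_sub_sq_pos (by rwa [abs_of_nonneg hx])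
  have hc := Real.sqrt_pos.2 h0
  have hc1 := sqrt_one_sub_sq_le_one x
  have hsq := Real.sq_sqrt h0.le
  unfold profile profileDeriv
  set c := √(1 - x ^ 2)
  have hx2 : x ^ 2 = 1 - c ^ 2 := by linarith
  have hc3 : c ^ 3 ≤ c := by nlinarith [mul_nonneg hc.le (sub_nonneg.2 hc1)]
  -- With `p = profile`, nonnegativity of the right-hand form needs `p' / p ≥ 1 / (x c)`. Equality
  -- holds for `(1 - c) / x`; the extra factor `x²` in `profile` adds `2 / x` to `p' / p`, which
  -- pays for the left-hand side. After the common factor `x (1 - c) / (2 c)` is removed, `A B - k²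
  -- = c² (2 c + c⁴)`.
  have key := quadratic_nonneg (A := 3 * c + 1 - c ^ 3) (B := c + 1 - c ^ 3)
    (k := x * (2 * c + 1)) (by nlinarith) (by nlinarith) (by
      rw [mul_pow, hx2]
      have : 0 ≤ c ^ 2 * (2 * c + c ^ 4) := by positivity
      nlinarith) ha hb hm
  have hfac : 0 ≤ x * (1 - c) / (2 * c) :=
    div_nonneg (mul_nonneg hx (by linarith)) (by positivity)
  have hprod := mul_nonneg hfac key
  rw [← sub_nonneg]
  refine hprod.trans_eq ?_
  rw [show x * (1 - c) / (2 * c) * ((3 * c + 1 - c ^ 3) * a + (c + 1 - c ^ 3) * b +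
      2 * (x * (2 * c + 1) * m)) = x * (1 - c) / (2 * c) * ((3 * c + 1 - c ^ 3) * a +
      (c + 1 - c ^ 3) * b) + x ^ 2 * ((1 - c) / c * (2 * c + 1) * m) by field_simp, hx2]
  field_simp
  ring

/-- The region `|r| < t + β`, `t > 0`, in which the weight is smooth. -/
def shiftedCone (β : ℝ) : Set (ℝ × ℝ) := {z | 0 < z.2 ∧ |z.1| < z.2 + β}

theorem isOpen_shiftedCone (β : ℝ) : IsOpen (shiftedCone β) :=
  (isOpen_lt continuous_const continuous_snd).inter
    (isOpen_lt continuous_fst.abs (continuous_snd.add continuous_const))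

/-- The coefficient of `∂ᵣ` in the multiplier, `profile (r / (t + β))`. -/
noncomputable def weight (β : ℝ) (z : ℝ × ℝ) : ℝ := profile (z.1 / (z.2 + β))

theorem abs_div_lt_one_of_mem {β : ℝ} {z : ℝ × ℝ} (hz : z ∈ shiftedCone β) :
    |z.1 / (z.2 + β)| < 1 := by
  have h : 0 < z.2 + β := (abs_nonneg _).trans_lt hz.2
  rw [abs_div, abs_of_pos h, div_lt_one h]
  exact hz.2

theorem contDiffOn_weight (β : ℝ) : ContDiffOn ℝ 1 (weight β) (shiftedCone β) := by
  intro z hz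
  have h : z.2 + β ≠ 0 := ((abs_nonneg _).trans_lt hz.2).ne'
  exact (ContDiffAt.comp z (contDiffAt_profile (abs_div_lt_one_of_mem hz))
    (contDiffAt_fst.div (contDiffAt_snd.add contDiffAt_const) h)).contDiffWithinAt

theorem fderiv_weight {β r t : ℝ} (hz : (r, t) ∈ shiftedCone β) :
    fderiv ℝ (weight β) (r, t) (1, 0) = profileDeriv (r / (t + β)) / (t + β) ∧
    fderiv ℝ (weight β) (r, t) (0, 1) =
      -(r / (t + β) * profileDeriv (r / (t + β)) / (t + β)) := by
  have h : 0 < t + β := (abs_nonneg _).trans_lt hz.2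
  have hp := hasDerivAt_profile (abs_div_lt_one_of_mem hz)
  have hw : HasFDerivAt (weight β) (fderiv ℝ (weight β) (r, t)) (r, t) :=
    (((contDiffOn_weight β).contDiffAt ((isOpen_shiftedCone β).mem_nhds hz)).differentiableAt
      one_ne_zero).hasFDerivAt
  constructor
  · have h1 : HasDerivAt (fun r => weight β (r, t)) (fderiv ℝ (weight β) (r, t) (1, 0)) r :=
      HasFDerivAt.comp_hasDerivAt (f := fun r => (r, t)) r hw
        ((hasDerivAt_id r).prodMk (hasDerivAt_const r t))
    have h2 : HasDerivAt (fun r => weight β (r, t)) (profileDeriv (r / (t + β)) * (1 / (t + β))) r :=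
      HasDerivAt.comp r hp ((hasDerivAt_id r).div_const (t + β))
    rw [h1.unique h2]; ring
  · have h1 : HasDerivAt (fun t => weight β (r, t)) (fderiv ℝ (weight β) (r, t) (0, 1)) t :=
      HasFDerivAt.comp_hasDerivAt (f := fun t => (r, t)) t hw
        ((hasDerivAt_const t r).prodMk (hasDerivAt_id t))
    have h3 : HasDerivAt (fun t => r / (t + β)) (-(r / (t + β) ^ 2)) t := by
      refine ((hasDerivAt_const t r).div ((hasDerivAt_id t).add_const β) h.ne').congr_deriv ?_
      simp [neg_div]
    have h2 : HasDerivAt (fun t => weight β (r, t))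
        (profileDeriv (r / (t + β)) * (-(r / (t + β) ^ 2))) t :=
      HasDerivAt.comp t hp h3
    rw [h1.unique h2]; field_simp

/-! ### The weighted momentum and the decay of energy in annuli. -/

namespace RadialDensities

variable {W : RadialDensities}

/-- The divergence of the current of the multiplier `weight β ∂ᵣ`. -/
noncomputable def bulk (W : RadialDensities) (β : ℝ) (z : ℝ × ℝ) : ℝ :=
  fderiv ℝ (fun z => weight β z * W.energyDensity z) z (1, 0)
    - fderiv ℝ (fun z => weight β z * W.momentumDensity z) z (0, 1)

theorem shiftedCone_subset (β : ℝ) : shiftedCone β ⊆ positiveTime := fun _ h => h.1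

theorem contDiffOn_weight_mul {f : ℝ × ℝ → ℝ} (hf : ContDiffOn ℝ 1 f positiveTime) (β : ℝ) :
    ContDiffOn ℝ 1 (fun z => weight β z * f z) (shiftedCone β) :=
  (contDiffOn_weight β).mul (hf.mono (shiftedCone_subset β))

theorem fderiv_weight_mul {f : ℝ × ℝ → ℝ} (hf : ContDiffOn ℝ 1 f positiveTime) {β : ℝ}
    {z : ℝ × ℝ} (hz : z ∈ shiftedCone β) (v : ℝ × ℝ) :
    fderiv ℝ (fun z => weight β z * f z) z v =
      weight β z * fderiv ℝ f z v + f z * fderiv ℝ (weight β) z v := by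
  have h1 := (((contDiffOn_weight β).contDiffAt ((isOpen_shiftedCone β).mem_nhds hz)).differentiableAt
      one_ne_zero)
  have h2 := ((hf.contDiffAt (isOpen_positiveTime.mem_nhds hz.1)).differentiableAt one_ne_zero)
  rw [fderiv_fun_mul h1 h2]
  simp

/-- The momentum law cancels `∂ᵣe`. With `x = r / (t + β)` there remains exactly the quadratic form
of `profile_coercive`. -/
theorem bulk_ge {β r t : ℝ} (hr : 0 < r) (hz : (r, t) ∈ shiftedCone β) :
    profile (r / (t + β)) * (1 - (r / (t + β)) ^ 2) * ((W.kin (r, t) + W.grad (r, t)) / 2) ≤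
      W.bulk β (r, t) := by
  have ht : 0 < t := hz.1
  have h : 0 < t + β := (abs_nonneg _).trans_lt hz.2
  have hx1 := abs_div_lt_one_of_mem hz
  have hx : 0 ≤ r / (t + β) := by positivity
  refine (profile_coercive hx ((le_abs_self _).trans_lt hx1) (W.kin_nonneg _) (W.grad_nonneg _)
    (W.mom_sq_le _)).trans (le_of_eq ?_)
  rw [bulk, fderiv_weight_mul W.contDiffOn_energyDensity hz,
    fderiv_weight_mul W.contDiffOn_momentumDensity hz, (fderiv_weight hz).1, (fderiv_weight hz).2]
  have hm := W.momentum_law r t hr ht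
  change fderiv ℝ W.momentumDensity (r, t) (0, 1) =
    fderiv ℝ W.energyDensity (r, t) (1, 0) - _ at hm
  rw [hm, energyDensity, momentumDensity, weight]
  field_simp
  ring

/-- The radial momentum weighted by `weight (R + 1)`. -/
noncomputable def virial (W : RadialDensities) (R t : ℝ) : ℝ :=
  ∫ r in (0 : ℝ)..(R + 1 * t), weight (R + 1) (r, t) * W.momentumDensity (r, t)

theorem mem_shiftedCone {R r t : ℝ} (ht : 0 < t) (hr : 0 ≤ r) (hr' : r ≤ R + t) :
    (r, t) ∈ shiftedCone (R + 1) :=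
  ⟨ht, by simp only [abs_of_nonneg hr]; linarith⟩

theorem continuousOn_slice {X : Type*} [TopologicalSpace X] {f : ℝ × ℝ → X} {R t : ℝ}
    (hf : ContinuousOn f (shiftedCone (R + 1))) (ht : 0 < t) :
    ContinuousOn (fun r => f (r, t)) (Icc 0 (R + t)) :=
  hf.comp (by fun_prop) (fun _ hr => mem_shiftedCone ht hr.1 hr.2)

theorem continuousOn_fderiv_weight_mul {f : ℝ × ℝ → ℝ} (hf : ContDiffOn ℝ 1 f positiveTime)
    (R : ℝ) (v : ℝ × ℝ) {t : ℝ} (ht : 0 < t) :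
    ContinuousOn (fun r => fderiv ℝ (fun z => weight (R + 1) z * f z) (r, t) v)
      (Icc 0 (R + t)) :=
  continuousOn_slice (f := fun z => fderiv ℝ (fun z => weight (R + 1) z * f z) z v)
    (((contDiffOn_weight_mul hf (R + 1)).continuousOn_fderiv_of_isOpen
      (isOpen_shiftedCone _) le_rfl).clm_apply continuousOn_const) ht

theorem continuousOn_bulk (R : ℝ) {t : ℝ} (ht : 0 < t) :
    ContinuousOn (fun r => W.bulk (R + 1) (r, t)) (Icc 0 (R + t)) :=
  (continuousOn_fderiv_weight_mul W.contDiffOn_energyDensity R _ ht).sub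
    (continuousOn_fderiv_weight_mul W.contDiffOn_momentumDensity R _ ht)

/-- No boundary terms survive: the weight vanishes at `r = 0`, and the densities vanish at `r = R +
t` by finite speed. The shift `R + 1` keeps that endpoint strictly inside the region where the
weight is smooth. -/
theorem hasDerivAt_virial {R : ℝ} (hR : 0 ≤ R)
    (hsupp : ∀ r, R ≤ r → W.energyDensity (r, 1) = 0) {t : ℝ} (ht : 1 ≤ t) :
    HasDerivAt (W.virial R) (-∫ r in (0 : ℝ)..(R + t), W.bulk (R + 1) (r, t)) t := by
  have ht0 : 0 < t := by linarith
  have hRt : 0 ≤ R + t := by linarith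
  refine (hasDerivAt_integral_affine_endpoint (isOpen_shiftedCone (R + 1))
    (contDiffOn_weight_mul W.contDiffOn_momentumDensity (R + 1)) R 1 t ?_).congr_deriv ?_
  · intro s hs
    rw [one_mul]
    exact mem_shiftedCone ht0 (mul_nonneg hRt hs.1) (mul_le_of_le_one_right hRt hs.2)
  have i1 := (continuousOn_fderiv_weight_mul W.contDiffOn_energyDensity R (1, 0)
    ht0).intervalIntegrable_of_Icc (μ := volume) hRt
  have i2 := (continuousOn_fderiv_weight_mul W.contDiffOn_momentumDensity R (0, 1)
    ht0).intervalIntegrable_of_Icc (μ := volume) hRt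
  have hftc : ∫ r in (0 : ℝ)..(R + t),
      fderiv ℝ (fun z => weight (R + 1) z * W.energyDensity z) (r, t) (1, 0) = 0 := by
    rw [intervalIntegral.integral_eq_sub_of_hasDerivAt_of_le
      (f := fun r => weight (R + 1) (r, t) * W.energyDensity (r, t)) hRt
      (continuousOn_slice (contDiffOn_weight_mul W.contDiffOn_energyDensity
        (R + 1)).continuousOn ht0) _ i1]
    · simp [energyDensity_eq_zero hR hsupp ht le_rfl, weight, profile]
    · intro r hr
      have hz := mem_shiftedCone ht0 hr.1.le hr.2.le
      have hw := (((contDiffOn_weight_mul W.contDiffOn_energyDensity (R + 1)).contDiffAt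
        ((isOpen_shiftedCone _).mem_nhds hz)).differentiableAt one_ne_zero).hasFDerivAt
      exact HasFDerivAt.comp_hasDerivAt (f := fun r => (r, t)) r hw
        ((hasDerivAt_id r).prodMk (hasDerivAt_const r t))
  simp only [bulk, one_mul]
  rw [intervalIntegral.integral_sub i1 i2, hftc, momentumDensity_eq_zero hR hsupp ht le_rfl]
  ring

theorem abs_virial_le {R : ℝ} (hR : 0 ≤ R)
    (hsupp : ∀ r, R ≤ r → W.energyDensity (r, 1) = 0) {t : ℝ} (ht : 0 < t) :
    |W.virial R t| ≤ W.ballEnergy 1 R := by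
  have hRt : 0 ≤ R + 1 * t := by linarith
  refine le_trans ?_ (ballEnergy_le_initial hsupp ht hRt)
  rw [virial, ← Real.norm_eq_abs]
  refine intervalIntegral.norm_integral_le_of_norm_le hRt (ae_of_all _ fun r hr => ?_)
    ((W.continuous_energyDensity ht).intervalIntegrable _ _)
  have hx : 0 ≤ r / (t + (R + 1)) := div_nonneg hr.1.le (by linarith)
  have hx1 : r / (t + (R + 1)) ≤ 1 := (div_le_one (by linarith)).2 (by linarith [hr.2])
  rw [norm_mul, Real.norm_eq_abs, Real.norm_eq_abs, weight, abs_of_nonneg (profile_nonneg hx)]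
  calc _ ≤ 1 * W.energyDensity (r, t) :=
        mul_le_mul (profile_le_one hx hx1) (W.abs_momentumDensity_le hr.1.le t) (abs_nonneg _)
          zero_le_one
    _ = _ := one_mul _

/-- The time derivative of the virial controls the energy in a self-similar annulus. -/
theorem integral_bulk_ge {R : ℝ} (hR : 0 ≤ R) {l₁ l₂ : ℝ} (h₁ : 0 < l₁) (h₁₂ : l₁ ≤ l₂)
    (h₂ : l₂ < 1) {t : ℝ} (ht : R + 1 ≤ t) :
    profile (l₁ / 2) * (1 - l₂ ^ 2) / t * (W.ballEnergy t (l₂ * t) - W.ballEnergy t (l₁ * t)) ≤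
      ∫ r in (0 : ℝ)..(R + t), W.bulk (R + 1) (r, t) := by
  have ht0 : 0 < t := by linarith
  have hp := profile_pos (half_pos h₁)
  have hl1 : 0 ≤ l₁ * t := by positivity
  have hl12 : l₁ * t ≤ l₂ * t := mul_le_mul_of_nonneg_right h₁₂ ht0.le
  have hl2 : l₂ * t ≤ t := mul_le_of_le_one_left ht0.le h₂.le
  have hl2' : l₂ * t ≤ R + t := by linarith
  have hint : IntervalIntegrable (fun r => W.bulk (R + 1) (r, t)) volume 0 (R + t) :=
    (continuousOn_bulk R ht0).intervalIntegrable_of_Icc (by linarith)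
  have hint' : IntervalIntegrable (fun r => W.bulk (R + 1) (r, t)) volume (l₁ * t) (l₂ * t) :=
    ((continuousOn_bulk R ht0).mono (Icc_subset_Icc hl1 hl2')).intervalIntegrable_of_Icc hl12
  rw [W.ballEnergy_sub ht0, ← intervalIntegral.integral_const_mul]
  calc ∫ r in (l₁ * t)..(l₂ * t), profile (l₁ / 2) * (1 - l₂ ^ 2) / t * W.energyDensity (r, t)
      ≤ ∫ r in (l₁ * t)..(l₂ * t), W.bulk (R + 1) (r, t) := by
        refine intervalIntegral.integral_mono_on hl12
          ((continuous_const.mul (W.continuous_energyDensity ht0)).intervalIntegrable _ _) hint' ?_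
        intro r hr
        have hr0 : 0 < r := (mul_pos h₁ ht0).trans_le hr.1
        refine le_trans ?_ (bulk_ge hr0 (mem_shiftedCone ht0 hr0.le (hr.2.trans hl2')))
        have hτ : 0 < t + (R + 1) := by linarith
        -- Since `R + 1 ≤ t`, the shifted denominator is at most `2 t`, which costs the factor two
        -- in `l₁ / 2`.
        have hx1 : l₁ / 2 ≤ r / (t + (R + 1)) := by
          rw [le_div_iff₀ hτ]
          nlinarith [hr.1]
        have hx2 : r / (t + (R + 1)) ≤ l₂ := by
          rw [div_le_iff₀ hτ]
          nlinarith [hr.2]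
        have hpm := profile_mono (half_pos h₁).le hx1
        have hsq : 1 - l₂ ^ 2 ≤ 1 - (r / (t + (R + 1))) ^ 2 := by
          have : 0 ≤ r / (t + (R + 1)) := by positivity
          nlinarith
        have hl0 : 0 ≤ 1 - l₂ ^ 2 := by nlinarith
        have hd : 0 ≤ (W.kin (r, t) + W.grad (r, t)) / 2 := by
          have := W.kin_nonneg (r, t)
          have := W.grad_nonneg (r, t)
          positivity
        -- The energy density has a factor `r` that the lower bound for `bulk` lacks; comparing it
        -- with `t` produces the `1 / t`.
        have hrt : r / t ≤ 1 := (div_le_one ht0).2 (hr.2.trans hl2)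
        calc profile (l₁ / 2) * (1 - l₂ ^ 2) / t * W.energyDensity (r, t)
            = (profile (l₁ / 2) * (1 - l₂ ^ 2)) *
                ((r / t) * ((W.kin (r, t) + W.grad (r, t)) / 2)) := by
              rw [energyDensity]; ring
          _ ≤ (profile (r / (t + (R + 1))) * (1 - (r / (t + (R + 1))) ^ 2)) *
                (1 * ((W.kin (r, t) + W.grad (r, t)) / 2)) := by
              gcongr
              · exact mul_nonneg (hp.le.trans hpm) (hl0.trans hsq)
              · exact hp.le.trans hpm
          _ = _ := by rw [one_mul]
    _ ≤ ∫ r in (0 : ℝ)..(R + t), W.bulk (R + 1) (r, t) := by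
        refine intervalIntegral.integral_mono_interval hl1 hl12 hl2' ?_ hint
        filter_upwards [ae_restrict_mem measurableSet_Ioc] with r hr
        refine le_trans ?_ (bulk_ge hr.1 (mem_shiftedCone ht0 hr.1.le hr.2))
        have hz := abs_div_lt_one_of_mem (mem_shiftedCone ht0 hr.1.le hr.2)
        have h1 := W.kin_nonneg (r, t)
        have h2 := W.grad_nonneg (r, t)
        have h3 := profile_nonneg (x := r / (t + (R + 1))) (div_nonneg hr.1.le (by linarith))
        have h4 := (one_sub_sq_pos hz).le
        exact mul_nonneg (mul_nonneg h3 h4) (by positivity)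

theorem antitoneOn_virial {R : ℝ} (hR : 0 ≤ R)
    (hsupp : ∀ r, R ≤ r → W.energyDensity (r, 1) = 0) :
    AntitoneOn (W.virial R) (Ici (R + 1)) := by
  refine antitoneOn_of_hasDerivWithinAt_nonpos (convex_Ici _)
    (fun t ht => (hasDerivAt_virial hR hsupp
      (by linarith [mem_Ici.1 ht])).continuousAt.continuousWithinAt)
    (fun t ht => (hasDerivAt_virial hR hsupp
      (by linarith [mem_Ici.1 (interior_subset ht)])).hasDerivWithinAt) fun t ht => ?_
  have ht := mem_Ici.1 (interior_subset ht)
  -- The degenerate annulus `l₁ = l₂` yields just the nonnegativity of the integral of `bulk`.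
  have := integral_bulk_ge (W := W) hR (l₁ := 1 / 2) (l₂ := 1 / 2) (by norm_num) le_rfl
    (by norm_num) ht
  rw [sub_self, mul_zero] at this
  linarith

theorem exists_virial_sub_lt {R : ℝ} (hR : 0 ≤ R)
    (hsupp : ∀ r, R ≤ r → W.energyDensity (r, 1) = 0) {ε : ℝ} (hε : 0 < ε) :
    ∃ S, R + 1 ≤ S ∧ ∀ s t, S ≤ s → S ≤ t → W.virial R s - W.virial R t < ε := by
  have hne : (W.virial R '' Ici (R + 1)).Nonempty := nonempty_Ici.image _
  have hbdd : BddBelow (W.virial R '' Ici (R + 1)) := by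
    refine ⟨-W.ballEnergy 1 R, ?_⟩
    rintro _ ⟨t, ht, rfl⟩
    exact neg_le_of_abs_le (abs_virial_le hR hsupp (by linarith [mem_Ici.1 ht]))
  obtain ⟨_, ⟨S, hS, rfl⟩, hlt⟩ := exists_lt_of_csInf_lt hne
    (lt_add_of_pos_right (sInf (W.virial R '' Ici (R + 1))) hε)
  refine ⟨S, hS, fun s t hs ht => ?_⟩
  have h1 := antitoneOn_virial hR hsupp hS (mem_Ici.2 ((mem_Ici.1 hS).trans hs)) hs
  have h2 := csInf_le hbdd (mem_image_of_mem (W.virial R) (mem_Ici.2 ((mem_Ici.1 hS).trans ht)))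
  linarith

/-- At late times, every interval `[s, (1 + δ) s]` contains a time at which the energy in the
annulus `l₁ t ≤ |x| ≤ l₂ t` is small. -/
theorem exists_annulus_energy_le {R : ℝ} (hR : 0 ≤ R)
    (hsupp : ∀ r, R ≤ r → W.energyDensity (r, 1) = 0) {l₁ l₂ : ℝ} (h₁ : 0 < l₁) (h₁₂ : l₁ ≤ l₂)
    (h₂ : l₂ < 1) {δ ε : ℝ} (hδ : 0 < δ) (hε : 0 < ε) :
    ∃ S, 0 < S ∧ ∀ s, S ≤ s → ∃ g ∈ Icc s (s + δ * s),
      W.ballEnergy g (l₂ * g) ≤ W.ballEnergy g (l₁ * g) + ε := by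
  have hκ : 0 < profile (l₁ / 2) * (1 - l₂ ^ 2) :=
    mul_pos (profile_pos (half_pos h₁)) (by nlinarith)
  set κ := profile (l₁ / 2) * (1 - l₂ ^ 2) with hκdef
  -- Energy above `ε` in the annulus at the mean-value time `g` would make the virial drop by at
  -- least `κ ε δ s / g`, and `g ≤ (1 + δ) s`.
  obtain ⟨S, hRS, hS⟩ := exists_virial_sub_lt hR hsupp
    (ε := ε * κ * δ / (1 + δ)) (by positivity)
  refine ⟨S, by linarith, fun s hs => ?_⟩
  have hs0 : 0 < s := by linarith
  have hlt : s < s + δ * s := by linarith [mul_pos hδ hs0]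
  obtain ⟨g, hg, hslope⟩ := exists_hasDerivAt_eq_slope (W.virial R) _ hlt
    (fun t ht => (hasDerivAt_virial hR hsupp
      (by linarith [ht.1])).continuousAt.continuousWithinAt)
    (fun t ht => hasDerivAt_virial hR hsupp (by linarith [ht.1]))
  refine ⟨g, Ioo_subset_Icc_self hg, ?_⟩
  have hg0 : 0 < g := hs0.trans hg.1
  have hb := integral_bulk_ge (W := W) hR h₁ h₁₂ h₂ (t := g) (by linarith [hg.1])
  rw [← hκdef] at hb
  have hv := hS s (s + δ * s) hs (by linarith)
  have hint : (∫ r in (0 : ℝ)..(R + g), W.bulk (R + 1) (r, g)) * (δ * s) =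
      W.virial R s - W.virial R (s + δ * s) := by
    have h3 : s + δ * s - s = δ * s := by ring
    have h4 : δ * s ≠ 0 := by positivity
    rw [h3, eq_div_iff h4] at hslope
    linarith
  by_contra! hcon
  have h5 : κ / g * ε * (δ * s) < ε * κ * δ / (1 + δ) := by
    refine lt_of_le_of_lt ?_ hv
    rw [← hint]
    refine mul_le_mul_of_nonneg_right (le_trans ?_ hb) (by positivity)
    exact mul_le_mul_of_nonneg_left (by linarith) (by positivity)
  have h6 : ε * κ * δ / (1 + δ) ≤ κ / g * ε * (δ * s) := by
    have : κ / g * ε * (δ * s) = ε * κ * δ * (s / g) := by ring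
    rw [this, div_eq_mul_inv]
    refine mul_le_mul_of_nonneg_left ?_ (by positivity)
    rw [inv_eq_one_div, div_le_div_iff₀ (by positivity) hg0]
    linarith [hg.2]
  linarith

/-! ### Comparison of the energies at all times of `[5T/8, 7T/8]`. -/

/-- If the energy in `|x| < l' t` is at most `X` at one time of `[5T/8, 7T/8]`, then it is at most
`X + ε` at all times of that interval, provided that `T` is large. -/
theorem exists_ballEnergy_le_add {R : ℝ} (hR : 0 ≤ R)
    (hsupp : ∀ r, R ≤ r → W.energyDensity (r, 1) = 0) {l' l'' : ℝ} (hl' : 0 < l') (hl : l' < l'')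
    (hl'' : l'' < 1) {ε : ℝ} (hε : 0 < ε) :
    ∃ T₀, 0 < T₀ ∧ ∀ T, T₀ ≤ T → ∀ s ∈ Icc (5 / 8 * T) (7 / 8 * T),
      ∀ t ∈ Icc (5 / 8 * T) (7 / 8 * T),
        W.ballEnergy t (l' * t) ≤ W.ballEnergy s (l' * s) + ε := by
  -- The first bound on `δ` gives `l' g / 2 + (g - s) ≤ l' s`, the second gives `l' t + |t - g| ≤
  -- l'' g`, for `s ≤ g ≤ s + δ s` and `|t - s| ≤ δ T`.
  obtain ⟨δ, hδ, hδ1, hδ2⟩ : ∃ δ > 0, δ ≤ l' / 8 ∧ δ ≤ (l'' - l') / 8 :=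
    ⟨min (l' / 8) ((l'' - l') / 8), lt_min (by linarith) (by linarith), min_le_left _ _,
      min_le_right _ _⟩
  -- `M` steps of length `δ T` cover a length `T`, and each may cost `ε / M`.
  obtain ⟨M, hM⟩ := exists_nat_gt (1 / δ)
  have hM0 : (0 : ℝ) < M := lt_trans (by positivity) hM
  obtain ⟨S, hS0, hS⟩ := exists_annulus_energy_le hR hsupp (l₁ := l' / 2) (l₂ := l'')
    (half_pos hl') (by linarith) hl'' hδ (ε := ε / M) (by positivity)
  refine ⟨2 * S, by linarith, fun T hT => ?_⟩
  have hT0 : 0 < T := by linarith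
  have step : ∀ s ∈ Icc (5 / 8 * T) (7 / 8 * T), ∀ t ∈ Icc (5 / 8 * T) (7 / 8 * T),
      |t - s| ≤ δ * T → W.ballEnergy t (l' * t) ≤ W.ballEnergy s (l' * s) + ε / M := by
    intro s hs t ht hst
    have hs0 : 0 < s := by linarith [hs.1]
    have ht0 : 0 < t := by linarith [ht.1]
    obtain ⟨g, hg, hann⟩ := hS s (by linarith [hs.1])
    have hg0 : 0 < g := by linarith [hg.1]
    have hδs : δ * s ≤ δ * T := mul_le_mul_of_nonneg_left (by linarith [hs.2]) hδ.le
    have hδT : δ * T ≤ (l'' - l') / 8 * T := mul_le_mul_of_nonneg_right hδ2 hT0.le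
    have hst' := abs_le.1 hst
    have h1 : W.ballEnergy t (l' * t) ≤ W.ballEnergy g (l'' * g) := by
      refine (W.ballEnergy_le hg0 ht0 (by positivity)).trans
        (W.ballEnergy_mono hg0 (by positivity) ?_)
      have e1 : |t - g| ≤ 2 * (δ * T) := abs_le.2 ⟨by linarith [hg.2], by linarith [hg.1]⟩
      have e2 : l' * (t - g) ≤ δ * T := by
        have : t - g ≤ δ * T := by linarith [hg.1]
        have h' : l' * (t - g) ≤ l' * (δ * T) := mul_le_mul_of_nonneg_left this hl'.le
        have h'' : l' * (δ * T) ≤ 1 * (δ * T) :=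
          mul_le_mul_of_nonneg_right (by linarith) (by positivity)
        linarith
      have e3 : (l'' - l') * (5 / 8 * T) ≤ (l'' - l') * g :=
        mul_le_mul_of_nonneg_left (by linarith [hg.1, hs.1]) (by linarith)
      have e4 : 0 < (l'' - l') * T := mul_pos (by linarith) hT0
      linarith
    have h2 : W.ballEnergy g (l' / 2 * g) ≤ W.ballEnergy s (l' * s) := by
      refine (W.ballEnergy_le hs0 hg0 (by positivity)).trans
        (W.ballEnergy_mono hs0 (by positivity) ?_)
      rw [abs_of_nonneg (by linarith [hg.1])]
      have e1 : δ * s ≤ l' / 8 * s := mul_le_mul_of_nonneg_right hδ1 hs0.le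
      have e2 : l' / 2 * (g - s) ≤ 1 * (g - s) :=
        mul_le_mul_of_nonneg_right (by linarith) (by linarith [hg.1])
      have e3 : 0 < l' * s := mul_pos hl' hs0
      linarith [hg.2]
    linarith
  intro s hs t ht
  have iter : ∀ j : ℕ, ∀ t ∈ Icc (5 / 8 * T) (7 / 8 * T), |t - s| ≤ j * (δ * T) →
      W.ballEnergy t (l' * t) ≤ W.ballEnergy s (l' * s) + j * (ε / M) := by
    intro j
    induction j with
    | zero =>
      intro t _ h
      have : t = s := by
        have := abs_nonpos_iff.1 (h.trans_eq (by simp)); linarith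
      simp [this]
    | succ j ih =>
      intro t ht h
      push_cast at h ⊢
      have hj : (0 : ℝ) < j + 1 := by positivity
      have hr0 : 0 ≤ (j : ℝ) / (j + 1) := by positivity
      have hr1 : 0 ≤ 1 - (j : ℝ) / (j + 1) := by
        rw [sub_nonneg, div_le_one hj]; linarith
      -- From the point at fraction `j / (j + 1)` of the way from `s` to `t`, a single step of
      -- length at most `δ T` remains.
      set c : ℝ := j / (j + 1) with hc
      have hmem : s + c * (t - s) ∈ Icc (5 / 8 * T) (7 / 8 * T) := by
        have := (convex_Icc (5 / 8 * T) (7 / 8 * T)) hs ht hr1 hr0 (by ring)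
        simp only [smul_eq_mul] at this
        rwa [show s + c * (t - s) = (1 - c) * s + c * t by ring]
      have hcj : c * (j + 1) = j := by rw [hc]; field_simp
      have hA := ih _ hmem (by
        rw [add_sub_cancel_left, abs_mul, abs_of_nonneg hr0]
        calc c * |t - s| ≤ c * ((j + 1) * (δ * T)) := mul_le_mul_of_nonneg_left h hr0
          _ = j * (δ * T) := by rw [← mul_assoc, hcj])
      have hB := step _ hmem t ht (by
        rw [show t - (s + c * (t - s)) = (1 - c) * (t - s) by ring, abs_mul, abs_of_nonneg hr1]
        calc (1 - c) * |t - s| ≤ (1 - c) * ((j + 1) * (δ * T)) :=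
              mul_le_mul_of_nonneg_left h hr1
          _ = ((j + 1) - c * (j + 1)) * (δ * T) := by ring
          _ = δ * T := by rw [hcj]; ring)
      linarith
  have := iter M t ht (by
    have h1 : |t - s| ≤ T := abs_le.2 ⟨by linarith [hs.2, ht.1], by linarith [hs.1, ht.2]⟩
    have h2 : 1 ≤ M * δ := by
      rw [div_lt_iff₀ hδ] at hM; exact hM.le
    calc |t - s| ≤ 1 * T := by linarith
      _ ≤ (M * δ) * T := mul_le_mul_of_nonneg_right h2 hT0.le
      _ = M * (δ * T) := by ring)
  rwa [mul_div_cancel₀ _ hM0.ne'] at this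

end RadialDensities

/-! ### From radial wave maps to radial densities. -/

theorem energy_nonneg {d : ℕ} (u : Spacetime → Eu d) (t : ℝ) (S : Set (Eu 2)) :
    0 ≤ energy u t S :=
  integral_nonneg fun _ => by positivity

theorem isOpen_future : IsOpen future := isOpen_lt continuous_const continuous_snd

section Target

variable {d k : ℕ} {N : Type*} [TopologicalSpace N] [ChartedSpace (Eu k) N]
  {ι : N → Eu d} {U : Spacetime → N}

theorem IsSmoothWaveMap.contDiffOn (hU : IsSmoothWaveMap k ι U)
    (hι : ContMDiff 𝓘(ℝ, Eu k) 𝓘(ℝ, Eu d) ∞ ι) : ContDiffOn ℝ ∞ (ι ∘ U) future :=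
  contMDiffOn_iff_contDiffOn.1 (hι.comp_contMDiffOn hU.smooth)

theorem IsSmoothWaveMap.pd_mem_tangentPlane (hU : IsSmoothWaveMap k ι U)
    (hι : ContMDiff 𝓘(ℝ, Eu k) 𝓘(ℝ, Eu d) ∞ ι) {z : Spacetime} (hz : z ∈ future)
    (e : Spacetime) : pd e (ι ∘ U) z ∈ tangentPlane (k := k) ι (U z) := by
  have h1 : MDifferentiableAt 𝓘(ℝ, Spacetime) 𝓘(ℝ, Eu k) U z :=
    (hU.smooth.contMDiffAt (isOpen_future.mem_nhds hz)).mdifferentiableAt (by simp)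
  have h2 : MDifferentiableAt 𝓘(ℝ, Eu k) 𝓘(ℝ, Eu d) ι (U z) :=
    (hι (U z)).mdifferentiableAt (by simp)
  refine ⟨tpd k e U z, ?_⟩
  have h3 := mfderiv_comp z h2 h1
  rw [mfderiv_eq_fderiv] at h3
  rw [pd, h3]
  rfl

theorem nonlinearity_mem_orthogonal (z : Spacetime) :
    nonlinearity k ι U z ∈ (tangentPlane (k := k) ι (U z))ᗮ :=
  add_mem (neg_mem (Submodule.starProjection_apply_mem _ _))
    (sum_mem fun _ _ => Submodule.starProjection_apply_mem _ _)

/-- This is how the nonlinearity disappears: it is normal to `N`, and the derivatives of the map are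
tangent. -/
theorem IsSmoothWaveMap.inner_box_pd (hU : IsSmoothWaveMap k ι U)
    (hι : ContMDiff 𝓘(ℝ, Eu k) 𝓘(ℝ, Eu d) ∞ ι) {z : Spacetime} (hz : z ∈ future)
    (e : Spacetime) : inner ℝ (box (ι ∘ U) z) (pd e (ι ∘ U) z) = 0 := by
  rw [hU.equation z hz]
  exact Submodule.inner_left_of_mem_orthogonal (hU.pd_mem_tangentPlane hι hz e)
    (nonlinearity_mem_orthogonal z)

end Target

section Radial

variable {d : ℕ} {u : Spacetime → Eu d}

theorem contDiffOn_pd (hu : ContDiffOn ℝ ∞ u future) (e : Spacetime) :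
    ContDiffOn ℝ ∞ (pd e u) future :=
  (hu.fderiv_of_isOpen isOpen_future (by simp)).clm_apply contDiffOn_const

theorem pd_comm (hu : ContDiffOn ℝ ∞ u future) {z : Spacetime} (hz : z ∈ future)
    (e f : Spacetime) : pd e (pd f u) z = pd f (pd e u) z := by
  have h2 : DifferentiableAt ℝ (fderiv ℝ u) z :=
    ((hu.fderiv_of_isOpen isOpen_future (m := ∞) (by simp)).contDiffAt
      (isOpen_future.mem_nhds hz)).differentiableAt (by simp)
  have h1 : ∀ e f : Spacetime, pd e (pd f u) z = fderiv ℝ (fderiv ℝ u) z e f := by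
    intro e f
    have : HasFDerivAt (pd f u) _ z := h2.hasFDerivAt.clm_apply (hasFDerivAt_const f z)
    rw [pd, this.fderiv]
    simp
  rw [h1, h1]
  exact ((hu.contDiffAt (isOpen_future.mem_nhds hz)).isSymmSndFDerivAt
    (by simpa using (WithTop.coe_le_coe (b := (2 : ℕ∞))).2 le_top)) e f

/-- The derivative along a curve in space-time. -/
theorem hasDerivAt_comp_curve (hu : ContDiffOn ℝ ∞ u future) {γ : ℝ → Spacetime} {γ' : Spacetime}
    {s : ℝ} (hγ : HasDerivAt γ γ' s) (hs : γ s ∈ future) :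
    HasDerivAt (fun s => u (γ s)) (pd γ' u (γ s)) s := by
  have h : HasFDerivAt u (fderiv ℝ u (γ s)) (γ s) :=
    ((hu.contDiffAt (isOpen_future.mem_nhds hs)).differentiableAt (by simp)).hasFDerivAt
  exact h.comp_hasDerivAt s hγ

/-- The inclusion of the half-line in the direction of the first coordinate, with time. -/
noncomputable def axis : ℝ × ℝ →L[ℝ] Spacetime :=
  ((ContinuousLinearMap.fst ℝ ℝ ℝ).smulRight (EuclideanSpace.single (0 : Fin 2) (1 : ℝ))).prod
    (ContinuousLinearMap.snd ℝ ℝ ℝ)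

theorem axis_apply (r t : ℝ) :
    axis (r, t) = (r • EuclideanSpace.single (0 : Fin 2) (1 : ℝ), t) := rfl

theorem axis_radial : axis (1, 0) = spaceDir 0 := by simp [axis_apply, spaceDir]

theorem axis_time : axis (0, 1) = timeDir := by simp [axis_apply, timeDir]

theorem axis_mem_future {z : ℝ × ℝ} (hz : z ∈ positiveTime) : axis z ∈ future := hz

theorem norm_axis_fst {r : ℝ} (hr : 0 ≤ r) (t : ℝ) : ‖(axis (r, t)).1‖ = r := by
  simp [axis_apply, norm_smul, abs_of_nonneg hr]

theorem IsRadial.eq_axis (hrad : IsRadial u) {t : ℝ} (ht : 0 < t) (x : Eu 2) :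
    u (x, t) = u (axis (‖x‖, t)) :=
  hrad t ht x _ (norm_axis_fst (norm_nonneg x) t).symm

theorem IsRadial.pd_timeDir (hrad : IsRadial u) (hu : ContDiffOn ℝ ∞ u future) {t : ℝ}
    (ht : 0 < t) (x : Eu 2) : pd timeDir u (x, t) = pd timeDir u (axis (‖x‖, t)) := by
  have h1 : HasDerivAt (fun s => u (x, s)) (pd timeDir u (x, t)) t :=
    hasDerivAt_comp_curve hu ((hasDerivAt_const t x).prodMk (hasDerivAt_id t)) ht
  have h2 : HasDerivAt (fun s => u (axis (‖x‖, s))) (pd timeDir u (axis (‖x‖, t))) t :=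
    hasDerivAt_comp_curve hu (γ := fun s => axis (‖x‖, s)) (axis_time ▸
      axis.hasFDerivAt.comp_hasDerivAt t ((hasDerivAt_const t _).prodMk (hasDerivAt_id t))) ht
  refine h1.unique (h2.congr_of_eventuallyEq ?_)
  filter_upwards [lt_mem_nhds ht] with s hs using hrad.eq_axis hs x

theorem hasDerivAt_norm_add_smul_single {x : Eu 2} (hx : x ≠ 0) (i : Fin 2) :
    HasDerivAt (fun s : ℝ => ‖x + s • EuclideanSpace.single i (1 : ℝ)‖) (x i / ‖x‖) 0 := by
  have h1 : HasDerivAt (fun s : ℝ => x + s • EuclideanSpace.single i (1 : ℝ))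
      (EuclideanSpace.single i (1 : ℝ)) 0 := by
    simpa using ((hasDerivAt_id (0 : ℝ)).smul_const
      (EuclideanSpace.single i (1 : ℝ) : Eu 2)).const_add x
  have h2 := h1.norm_sq.sqrt (by simpa using hx)
  simp only [Real.sqrt_sq (norm_nonneg _)] at h2
  refine h2.congr_deriv ?_
  have : inner ℝ x (EuclideanSpace.single i (1 : ℝ)) = x i := by
    simp [EuclideanSpace.inner_single_right]
  simp only [zero_smul, add_zero, this]
  rw [mul_div_mul_left _ _ two_ne_zero]

theorem IsRadial.pd_spaceDir (hrad : IsRadial u) (hu : ContDiffOn ℝ ∞ u future) {t : ℝ}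
    (ht : 0 < t) {x : Eu 2} (hx : x ≠ 0) (i : Fin 2) :
    pd (spaceDir i) u (x, t) = (x i / ‖x‖) • pd (spaceDir 0) u (axis (‖x‖, t)) := by
  have h1 : HasDerivAt (fun s : ℝ => u (x + s • EuclideanSpace.single i (1 : ℝ), t))
      (pd (spaceDir i) u (x, t)) 0 := by
    have hγ : HasDerivAt (fun s : ℝ => ((x + s • EuclideanSpace.single i (1 : ℝ), t) : Spacetime))
        (spaceDir i) 0 := by
      refine HasDerivAt.prodMk ?_ (hasDerivAt_const _ t)
      simpa using ((hasDerivAt_id (0 : ℝ)).smul_const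
        (EuclideanSpace.single i (1 : ℝ) : Eu 2)).const_add x
    simpa using hasDerivAt_comp_curve hu hγ (by simpa [future] using ht)
  have h2 : HasDerivAt (fun s : ℝ => u (axis (‖x + s • EuclideanSpace.single i (1 : ℝ)‖, t)))
      ((x i / ‖x‖) • pd (spaceDir 0) u (axis (‖x‖, t))) 0 := by
    have hγ : HasDerivAt (fun s : ℝ => axis (‖x + s • EuclideanSpace.single i (1 : ℝ)‖, t))
        (axis (x i / ‖x‖, 0)) 0 :=
      axis.hasFDerivAt.comp_hasDerivAt _
        ((hasDerivAt_norm_add_smul_single hx i).prodMk (hasDerivAt_const _ t))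
    have h3 := hasDerivAt_comp_curve hu hγ (axis_mem_future ht)
    refine h3.congr_deriv ?_
    have : axis (x i / ‖x‖, 0) = (x i / ‖x‖) • spaceDir 0 := by
      rw [← axis_radial, ← map_smul]; simp
    simp [this, pd]
  refine h1.unique (h2.congr_of_eventuallyEq ?_)
  exact Eventually.of_forall fun s => hrad.eq_axis ht _

/-- The second derivative of a radial function in the angular direction. -/
theorem IsRadial.pd_pd_spaceDir_one (hrad : IsRadial u) (hu : ContDiffOn ℝ ∞ u future) {r t : ℝ}
    (hr : 0 < r) (ht : 0 < t) :
    pd (spaceDir 1) (pd (spaceDir 1) u) (axis (r, t)) = r⁻¹ • pd (spaceDir 0) u (axis (r, t)) := by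
  let x : ℝ → Eu 2 := fun y => (axis (r, t)).1 + y • EuclideanSpace.single 1 (1 : ℝ)
  have hx0 : x 0 = (axis (r, t)).1 := by simp [x]
  have hxc : Continuous x := by fun_prop
  have hx_one : ∀ y, x y 1 = y := fun y => by simp [x, axis_apply]
  have hx_ne : ∀ y, x y ≠ 0 := by
    intro y h
    have : x y 0 = r := by simp [x, axis_apply]
    rw [h] at this
    simp at this
    exact hr.ne this
  have h1 : HasDerivAt (fun y : ℝ => pd (spaceDir 1) u (x y, t))
      (pd (spaceDir 1) (pd (spaceDir 1) u) (axis (r, t))) 0 := by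
    have hγ : HasDerivAt (fun y : ℝ => ((x y, t) : Spacetime)) (spaceDir 1) 0 := by
      refine HasDerivAt.prodMk ?_ (hasDerivAt_const _ t)
      simpa [x] using ((hasDerivAt_id (0 : ℝ)).smul_const
        (EuclideanSpace.single 1 (1 : ℝ) : Eu 2)).const_add (axis (r, t)).1
    have := hasDerivAt_comp_curve (contDiffOn_pd hu (spaceDir 1)) hγ ht
    rw [hx0] at this
    exact this
  -- On the line through `axis (r, t)` in the second coordinate direction, the derivative in that
  -- direction is `y • h y`. Continuity of `h` suffices for its derivative at `0` to be `h 0`.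
  let h : ℝ → Eu d := fun y => ‖x y‖⁻¹ • pd (spaceDir 0) u (axis (‖x y‖, t))
  have hh0 : h 0 = r⁻¹ • pd (spaceDir 0) u (axis (r, t)) := by
    simp only [h, hx0, norm_axis_fst hr.le]
  have hhc : Continuous h := by
    refine (hxc.norm.inv₀ fun y => norm_ne_zero_iff.2 (hx_ne y)).smul ?_
    exact (contDiffOn_pd hu _).continuousOn.comp_continuous
      (axis.continuous.comp (hxc.norm.prodMk continuous_const)) (fun y => ht)
  have h2 : HasDerivAt (fun y : ℝ => pd (spaceDir 1) u (x y, t)) (h 0) 0 := by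
    have e : (fun y : ℝ => pd (spaceDir 1) u (x y, t)) = fun y => y • h y := by
      funext y
      rw [hrad.pd_spaceDir hu ht (hx_ne y), hx_one, smul_smul, div_eq_mul_inv]
    rw [e, hasDerivAt_iff_tendsto_slope]
    refine ((hhc.tendsto 0).mono_left nhdsWithin_le_nhds).congr' ?_
    filter_upwards [self_mem_nhdsWithin] with y hy
    rw [slope_def_module]
    simp [smul_smul, inv_mul_cancel₀ (show y ≠ 0 from hy)]
  rw [← hh0]
  exact h1.unique h2

theorem contDiffOn_pd_axis (hu : ContDiffOn ℝ ∞ u future) (e : Spacetime) :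
    ContDiffOn ℝ 1 (fun z => pd e u (axis z)) positiveTime :=
  ((contDiffOn_pd hu e).of_le (by simp)).comp axis.contDiff.contDiffOn (fun _ h => h)

theorem fderiv_pd_axis (hu : ContDiffOn ℝ ∞ u future) (e : Spacetime) {z : ℝ × ℝ}
    (hz : z ∈ positiveTime) (w : ℝ × ℝ) :
    fderiv ℝ (fun z => pd e u (axis z)) z w = pd (axis w) (pd e u) (axis z) := by
  have h : HasFDerivAt (pd e u) (fderiv ℝ (pd e u) (axis z)) (axis z) :=
    (((contDiffOn_pd hu e).contDiffAt (isOpen_future.mem_nhds hz)).differentiableAt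
      (by simp)).hasFDerivAt
  have h2 : HasFDerivAt (fun z => pd e u (axis z)) _ z := h.comp z axis.hasFDerivAt
  rw [h2.fderiv]
  rfl

theorem contDiffOn_inner_pd_axis (hu : ContDiffOn ℝ ∞ u future) (e f : Spacetime) :
    ContDiffOn ℝ 1 (fun z => inner ℝ (pd e u (axis z)) (pd f u (axis z))) positiveTime :=
  (contDiffOn_pd_axis hu e).inner ℝ (contDiffOn_pd_axis hu f)

theorem fderiv_inner_pd_axis (hu : ContDiffOn ℝ ∞ u future) (e f : Spacetime) {z : ℝ × ℝ}
    (hz : z ∈ positiveTime) (w : ℝ × ℝ) :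
    fderiv ℝ (fun z => inner ℝ (pd e u (axis z)) (pd f u (axis z))) z w =
      inner ℝ (pd e u (axis z)) (pd (axis w) (pd f u) (axis z)) +
        inner ℝ (pd (axis w) (pd e u) (axis z)) (pd f u (axis z)) := by
  have hd : ∀ e, DifferentiableAt ℝ (fun z => pd e u (axis z)) z := fun e =>
    ((contDiffOn_pd_axis hu e).contDiffAt (isOpen_positiveTime.mem_nhds hz)).differentiableAt
      one_ne_zero
  rw [fderiv_inner_apply ℝ (hd e) (hd f), fderiv_pd_axis hu e hz, fderiv_pd_axis hu f hz]

theorem fderiv_fst_mul {f : ℝ × ℝ → ℝ} {z : ℝ × ℝ} (hf : DifferentiableAt ℝ f z) (w : ℝ × ℝ) :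
    fderiv ℝ (fun z : ℝ × ℝ => z.1 * f z) z w = z.1 * fderiv ℝ f z w + f z * w.1 := by
  rw [fderiv_fun_mul differentiableAt_fst hf]
  simp [fderiv_fst]

theorem fderiv_energy_integrand (hu : ContDiffOn ℝ ∞ u future) {z : ℝ × ℝ}
    (hz : z ∈ positiveTime) (w : ℝ × ℝ) :
    fderiv ℝ (fun z : ℝ × ℝ => z.1 * ((inner ℝ (pd timeDir u (axis z)) (pd timeDir u (axis z)) +
      inner ℝ (pd (spaceDir 0) u (axis z)) (pd (spaceDir 0) u (axis z))) / 2)) z w =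
      z.1 * (inner ℝ (pd (axis w) (pd timeDir u) (axis z)) (pd timeDir u (axis z)) +
        inner ℝ (pd (axis w) (pd (spaceDir 0) u) (axis z)) (pd (spaceDir 0) u (axis z))) +
      (inner ℝ (pd timeDir u (axis z)) (pd timeDir u (axis z)) +
        inner ℝ (pd (spaceDir 0) u (axis z)) (pd (spaceDir 0) u (axis z))) / 2 * w.1 := by
  have hd : ∀ e f, DifferentiableAt ℝ
      (fun z => inner ℝ (pd e u (axis z)) (pd f u (axis z))) z := fun e f =>
    ((contDiffOn_inner_pd_axis hu e f).contDiffAt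
      (isOpen_positiveTime.mem_nhds hz)).differentiableAt one_ne_zero
  have hs := (hd timeDir timeDir).fun_add (hd (spaceDir 0) (spaceDir 0))
  simp only [div_eq_mul_inv]
  rw [fderiv_fst_mul (hs.mul_const (2 : ℝ)⁻¹), fderiv_mul_const hs, fderiv_fun_add (hd _ _) (hd _ _)]
  simp only [smul_apply, add_apply, fderiv_inner_pd_axis hu _ _ hz, smul_eq_mul]
  rw [real_inner_comm (pd (axis w) (pd timeDir u) (axis z)),
    real_inner_comm (pd (axis w) (pd (spaceDir 0) u) (axis z))]
  ring

/-- The angular second derivative supplies the first-order term of the radial Laplacian. The factor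
`r` clears its `1 / r` and matches the weight in the densities. -/
theorem IsRadial.box_axis (hrad : IsRadial u) (hu : ContDiffOn ℝ ∞ u future) {r t : ℝ}
    (hr : 0 < r) (ht : 0 < t) :
    r • box u (axis (r, t)) = pd (spaceDir 0) u (axis (r, t)) +
      r • (pd (spaceDir 0) (pd (spaceDir 0) u) (axis (r, t))
        - pd timeDir (pd timeDir u) (axis (r, t))) := by
  rw [box, Fin.sum_univ_two, hrad.pd_pd_spaceDir_one hu hr ht, smul_add, smul_add, smul_smul,
    mul_inv_cancel₀ hr.ne', one_smul, smul_neg, smul_sub]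
  abel

/-- The densities of a smooth radial map whose wave operator is orthogonal to its derivatives. -/
noncomputable def radialDensities (hu : ContDiffOn ℝ ∞ u future) (hrad : IsRadial u)
    (horth : ∀ z ∈ future, ∀ e, inner ℝ (box u z) (pd e u z) = 0) : RadialDensities where
  kin z := inner ℝ (pd timeDir u (axis z)) (pd timeDir u (axis z))
  grad z := inner ℝ (pd (spaceDir 0) u (axis z)) (pd (spaceDir 0) u (axis z))
  mom z := inner ℝ (pd timeDir u (axis z)) (pd (spaceDir 0) u (axis z))
  contDiffOn_kin := contDiffOn_inner_pd_axis hu _ _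
  contDiffOn_grad := contDiffOn_inner_pd_axis hu _ _
  contDiffOn_mom := contDiffOn_inner_pd_axis hu _ _
  kin_nonneg _ := real_inner_self_nonneg
  grad_nonneg _ := real_inner_self_nonneg
  mom_sq_le _ := by rw [sq]; exact real_inner_mul_inner_self_le _ _
  energy_law r t hr ht := by
    have hz : (r, t) ∈ positiveTime := ht
    have hd := ((contDiffOn_inner_pd_axis hu timeDir (spaceDir 0)).contDiffAt
      (isOpen_positiveTime.mem_nhds hz)).differentiableAt one_ne_zero
    -- Orthogonality to `∂ₜu`, multiplied by `r`, is the energy law; below, orthogonality to `∂ᵣu`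
    -- gives the momentum law.
    have ho := congrArg (r * ·) (horth (axis (r, t)) hz timeDir)
    rw [fderiv_energy_integrand hu hz, fderiv_fst_mul hd, fderiv_inner_pd_axis hu _ _ hz,
      axis_radial, axis_time, pd_comm hu (axis_mem_future hz) (spaceDir 0) timeDir]
    simp only [mul_zero, ← real_inner_smul_left, hrad.box_axis hu hr ht] at ho
    rw [inner_add_left, real_inner_smul_left, inner_sub_left] at ho
    rw [real_inner_comm (pd (spaceDir 0) (pd (spaceDir 0) u) (axis (r, t))),
      real_inner_comm (pd (spaceDir 0) u (axis (r, t))) (pd timeDir u (axis (r, t)))]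
    linarith
  momentum_law r t hr ht := by
    have hz : (r, t) ∈ positiveTime := ht
    have hd := ((contDiffOn_inner_pd_axis hu timeDir (spaceDir 0)).contDiffAt
      (isOpen_positiveTime.mem_nhds hz)).differentiableAt one_ne_zero
    have ho := congrArg (r * ·) (horth (axis (r, t)) hz (spaceDir 0))
    rw [fderiv_energy_integrand hu hz, fderiv_fst_mul hd, fderiv_inner_pd_axis hu _ _ hz,
      axis_radial, axis_time, pd_comm hu (axis_mem_future hz) (spaceDir 0) timeDir]
    simp only [mul_zero, ← real_inner_smul_left, hrad.box_axis hu hr ht] at ho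
    rw [inner_add_left, real_inner_smul_left, inner_sub_left] at ho
    rw [real_inner_comm (pd timeDir (pd (spaceDir 0) u) (axis (r, t)))]
    linarith

/-- In the constant, one factor `2` is the dimension, from polar coordinates; the other undoes the
half in `energyDensity`. -/
theorem energy_eq_ballEnergy (hu : ContDiffOn ℝ ∞ u future) (hrad : IsRadial u)
    (horth : ∀ z ∈ future, ∀ e, inner ℝ (box u z) (pd e u z) = 0) {t ρ : ℝ} (ht : 0 < t)
    (hρ : 0 ≤ ρ) :
    energy u t (Metric.ball 0 ρ) = 4 * volume.real (Metric.ball (0 : Eu 2) 1) *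
      (radialDensities hu hrad horth).ballEnergy t ρ := by
  set W := radialDensities hu hrad horth
  let f : ℝ → ℝ := fun r => W.kin (r, t) + W.grad (r, t)
  have hae : ∀ᵐ x : Eu 2, ‖pd timeDir u (x, t)‖ ^ 2 + ∑ i : Fin 2, ‖pd (spaceDir i) u (x, t)‖ ^ 2 =
      f ‖x‖ := by
    have h0 : ∀ᵐ x : Eu 2, x ≠ 0 := by simp [ae_iff]
    filter_upwards [h0] with x hx
    have hn : ‖x‖ ^ 2 ≠ 0 := by simpa using hx
    have hs : ‖x‖ ^ 2 = x 0 ^ 2 + x 1 ^ 2 := by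
      rw [EuclideanSpace.norm_sq_eq, Fin.sum_univ_two]; simp
    rw [Fin.sum_univ_two, hrad.pd_timeDir hu ht, hrad.pd_spaceDir hu ht hx 0,
      hrad.pd_spaceDir hu ht hx 1]
    simp only [norm_smul, f, W, radialDensities, real_inner_self_eq_norm_sq, mul_pow,
      Real.norm_eq_abs, sq_abs, div_pow]
    rw [← add_mul, ← add_div, ← hs, div_self hn, one_mul]
  have h1 : energy u t (Metric.ball 0 ρ) = ∫ x : Eu 2, (Iio ρ).indicator f ‖x‖ := by
    rw [energy, ← integral_indicator measurableSet_ball]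
    refine integral_congr_ae ?_
    filter_upwards [hae] with x hx
    by_cases hxρ : ‖x‖ < ρ
    · rw [indicator_of_mem (by simpa using hxρ), indicator_of_mem (mem_Iio.2 hxρ), hx]
    · rw [indicator_of_notMem (by simpa using hxρ), indicator_of_notMem (by simpa using hxρ)]
  rw [h1, integral_fun_norm_addHaar, finrank_euclideanSpace_fin]
  have h2 : ∫ y in Ioi (0 : ℝ), y ^ (2 - 1) • (Iio ρ).indicator f y = 2 * W.ballEnergy t ρ := by
    have e : ∀ y, y ^ (2 - 1) • (Iio ρ).indicator f y =
        (Iio ρ).indicator (fun y => 2 * W.energyDensity (y, t)) y := by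
      intro y
      by_cases hy : y ∈ Iio ρ
      · simp only [indicator_of_mem hy, RadialDensities.energyDensity, f, smul_eq_mul]
        norm_num
        ring
      · simp [indicator_of_notMem hy]
    simp only [e]
    rw [setIntegral_indicator measurableSet_Iio, RadialDensities.ballEnergy,
      intervalIntegral.integral_of_le hρ, integral_Ioc_eq_integral_Ioo, integral_const_mul,
      Ioi_inter_Iio]
  rw [h2]
  simp only [nsmul_eq_mul, smul_eq_mul]
  push_cast
  ring

theorem exists_energyDensity_eq_zero (hu : ContDiffOn ℝ ∞ u future) (hrad : IsRadial u)
    (horth : ∀ z ∈ future, ∀ e, inner ℝ (box u z) (pd e u z) = 0)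
    (hsupp : HasCompactlySupportedDerivatives u) :
    ∃ R, 0 ≤ R ∧ ∀ r, R ≤ r → (radialDensities hu hrad horth).energyDensity (r, 1) = 0 := by
  have key : ∀ f : Eu 2 → Eu d, HasCompactSupport f → ∃ R, ∀ x, R < ‖x‖ → f x = 0 := by
    intro f hf
    obtain ⟨R, hR⟩ := hf.isCompact.isBounded.subset_closedBall 0
    refine ⟨R, fun x hx => image_eq_zero_of_notMem_tsupport fun h => ?_⟩
    have := hR h
    rw [mem_closedBall_zero_iff] at this
    linarith
  obtain ⟨R₁, h₁⟩ := key _ (hsupp 1 one_pos).1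
  obtain ⟨R₂, h₂⟩ := key _ ((hsupp 1 one_pos).2 0)
  refine ⟨max 0 (max R₁ R₂) + 1, by positivity, fun r hr => ?_⟩
  have hr0 : 0 ≤ r := by linarith [le_max_left 0 (max R₁ R₂)]
  have hR : max R₁ R₂ < r := by linarith [le_max_right 0 (max R₁ R₂)]
  have hn := norm_axis_fst hr0 1
  have e₁ : pd timeDir u (axis (r, 1)) = 0 :=
    h₁ (axis (r, 1)).1 (by rw [hn]; exact (le_max_left _ _).trans_lt hR)
  have e₂ : pd (spaceDir 0) u (axis (r, 1)) = 0 :=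
    h₂ (axis (r, 1)).1 (by rw [hn]; exact (le_max_right _ _).trans_lt hR)
  simp [RadialDensities.energyDensity, radialDensities, e₁, e₂]

end Radial

end WaveMap

theorem lemma3 (l' l'' : ℝ) (hl' : 0 < l') (hl : l' < l'') (hl'' : l'' < 1) :
    ∃ α : ℝ, α ∈ Set.Ioo (0 : ℝ) 1 ∧
      ∀ (d k : ℕ) (N : Type*) [TopologicalSpace N] [T2Space N] [CompactSpace N]
        [ChartedSpace (WaveMap.Eu k) N] [IsManifold 𝓘(ℝ, WaveMap.Eu k) ∞ N]
        (ι : N → WaveMap.Eu d)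
        (_ : Manifold.IsSmoothEmbedding 𝓘(ℝ, WaveMap.Eu k) 𝓘(ℝ, WaveMap.Eu d) ∞ ι)
        (U : WaveMap.Spacetime → N)
        (_ : WaveMap.IsSmoothWaveMap k ι U)
        (_ : WaveMap.IsRadial U)
        (_ : WaveMap.HasCompactlySupportedDerivatives (ι ∘ U))
        (η : ℝ) (_ : 0 < η) (T : ℕ → ℝ) (_ : Tendsto T atTop atTop)
        (_ : Tendsto (fun n => WaveMap.averagedEnergy (ι ∘ U) l' (T n)) atTop (𝓝 η)),
        ∀ᶠ n in atTop, ∀ t ∈ Set.Icc (5 / 8 * T n) (7 / 8 * T n),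
          α * η < WaveMap.energy (ι ∘ U) t (Metric.ball 0 (l' * t)) := by
  -- Since the time interval has length `T / 4`, the value `1 / 2` works for all `l'` and `l''`:
  -- allowing an error of `η / 2` in the energy gives an average of at most `η / 4`, below the
  -- limit.
  refine ⟨1 / 2, by norm_num, ?_⟩
  intro d k N _ _ _ _ _ ι hι U hU hrad hsupp η hη T hT hlim
  have hι' := hι.contMDiff
  have hu := hU.contDiffOn hι'
  have hradu : WaveMap.IsRadial (ι ∘ U) := fun t ht x y h => congrArg ι (hrad t ht x y h)
  have horth : ∀ z ∈ WaveMap.future, ∀ e,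
      inner ℝ (WaveMap.box (ι ∘ U) z) (WaveMap.pd e (ι ∘ U) z) = 0 :=
    fun z hz e => hU.inner_box_pd hι' hz e
  obtain ⟨R, hR, hRsupp⟩ := WaveMap.exists_energyDensity_eq_zero hu hradu horth hsupp
  have hvol : 0 < volume.real (Metric.ball (0 : WaveMap.Eu 2) 1) :=
    ENNReal.toReal_pos (Metric.measure_ball_pos _ _ one_pos).ne' measure_ball_lt_top.ne
  set c := 4 * volume.real (Metric.ball (0 : WaveMap.Eu 2) 1)
  have hc0 : 0 < c := by positivity
  obtain ⟨T₀, hT₀, hprop⟩ := WaveMap.RadialDensities.exists_ballEnergy_le_add hR hRsupp hl' hl hl''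
    (ε := η / (2 * c)) (by positivity)
  filter_upwards [hT.eventually_ge_atTop T₀, hlim.eventually (lt_mem_nhds (half_lt_self hη))]
    with n hn hav s hs
  by_contra! hcon
  have hTn : 0 < T n := hT₀.trans_le hn
  have hE : ∀ t ∈ Set.Icc (5 / 8 * T n) (7 / 8 * T n),
      WaveMap.energy (ι ∘ U) t (Metric.ball 0 (l' * t)) =
        c * (WaveMap.radialDensities hu hradu horth).ballEnergy t (l' * t) := by
    intro t ht
    have ht0 : 0 < t := by linarith [ht.1]
    exact WaveMap.energy_eq_ballEnergy hu hradu horth ht0 (by positivity)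
  have hbound : ∀ t ∈ Set.Icc (5 / 8 * T n) (7 / 8 * T n),
      WaveMap.energy (ι ∘ U) t (Metric.ball 0 (l' * t)) ≤ η := by
    intro t ht
    have h1 := mul_le_mul_of_nonneg_left (hprop (T n) hn s hs t ht) hc0.le
    rw [mul_add, ← hE t ht, ← hE s hs, show c * (η / (2 * c)) = η / 2 by field_simp] at h1
    linarith
  have hle : 5 / 8 * T n ≤ 7 / 8 * T n := by linarith
  have hint := intervalIntegral.norm_integral_le_of_norm_le_const (C := η)
    (f := fun t => WaveMap.energy (ι ∘ U) t (Metric.ball 0 (l' * t)))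
    (a := 5 / 8 * T n) (b := 7 / 8 * T n) (fun t ht => by
      rw [Set.uIoc_of_le hle] at ht
      rw [Real.norm_of_nonneg (WaveMap.energy_nonneg _ _ _)]
      exact hbound t (Set.Ioc_subset_Icc_self ht))
  rw [abs_of_nonneg (by linarith)] at hint
  have hint' := (le_abs_self _).trans hint
  have : WaveMap.averagedEnergy (ι ∘ U) l' (T n) ≤ η / 4 := by
    rw [WaveMap.averagedEnergy, one_div, inv_mul_le_iff₀ hTn]
    linarith
  linarith
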